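/- Let $\mathbb{F}_4$ be the field with four elements and let $R$ be (up to isomorphism) one of the three rings $\mathbb{G}_4=\mathbb{Z}_4[X]/(X^2+X+1)$, $\mathbb{S}_4=\mathbb{F}_4[X]/(X^2)$, $\mathbb{T}_4=\mathbb{F}_4[X;a\mapsto a^2]/(X^2)$ (truncated skew polynomials, with $Xa=a^2X$). Let $\mathrm{PHG}(2,R)$ be the right projective Hjelmslev plane over $R$: its points (respectively lines) are the free submodules of rank $1$ (respectively rank $2$) of the free right $R$-module $R^3_R$, and incidence is set inclusion. A projective $(k,n)$-arc in $\mathrm{PHG}(2,R)$ is a set of $k$ points meeting every line in at most $n$ points, and $\mathrm{m}_n(R)$ denotes the largest $k$ for which a projective $(k,n)$-arc in $\mathrm{PHG}(2,R)$ exists. Then: (i) $\mathrm{m}_6(R)\le 84$; (ii) $\mathrm{m}_6(R)<84$ if $R\not\cong\mathbb{G}_4$. -/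

import Mathlib

/-- The truncated skew polynomial ring `F[X; σ]/(X²)`. Its elements are the expressions `a + b X`
with coefficients written on the left; multiplication is determined by `X c = σ(c) X`, `X² = 0`. -/
@[ext]
structure TruncSkewPoly (F : Type*) [CommRing F] (σ : F →+* F) where
  /-- the constant coefficient -/
  c0 : F
  /-- the coefficient of `X` -/
  c1 : F

namespace TruncSkewPoly

variable {F : Type*} [CommRing F] {σ : F →+* F}

instance : Zero (TruncSkewPoly F σ) := ⟨⟨0, 0⟩⟩
instance : One (TruncSkewPoly F σ) := ⟨⟨1, 0⟩⟩
instance : Add (TruncSkewPoly F σ) := ⟨fun x y => ⟨x.c0 + y.c0, x.c1 + y.c1⟩⟩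
instance : Neg (TruncSkewPoly F σ) := ⟨fun x => ⟨-x.c0, -x.c1⟩⟩
instance : Mul (TruncSkewPoly F σ) :=
  ⟨fun x y => ⟨x.c0 * y.c0, x.c0 * y.c1 + x.c1 * σ y.c0⟩⟩

@[simp] theorem zero_c0 : (0 : TruncSkewPoly F σ).c0 = 0 := rfl
@[simp] theorem zero_c1 : (0 : TruncSkewPoly F σ).c1 = 0 := rfl
@[simp] theorem one_c0 : (1 : TruncSkewPoly F σ).c0 = 1 := rfl
@[simp] theorem one_c1 : (1 : TruncSkewPoly F σ).c1 = 0 := rfl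
@[simp] theorem add_c0 (x y : TruncSkewPoly F σ) : (x + y).c0 = x.c0 + y.c0 := rfl
@[simp] theorem add_c1 (x y : TruncSkewPoly F σ) : (x + y).c1 = x.c1 + y.c1 := rfl
@[simp] theorem neg_c0 (x : TruncSkewPoly F σ) : (-x).c0 = -x.c0 := rfl
@[simp] theorem neg_c1 (x : TruncSkewPoly F σ) : (-x).c1 = -x.c1 := rfl
@[simp] theorem mul_c0 (x y : TruncSkewPoly F σ) : (x * y).c0 = x.c0 * y.c0 := rfl
@[simp] theorem mul_c1 (x y : TruncSkewPoly F σ) :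
    (x * y).c1 = x.c0 * y.c1 + x.c1 * σ y.c0 := rfl

instance : Ring (TruncSkewPoly F σ) where
  add_assoc x y z := by ext <;> simp [add_assoc]
  zero_add x := by ext <;> simp
  add_zero x := by ext <;> simp
  add_comm x y := by ext <;> simp [add_comm]
  neg_add_cancel x := by ext <;> simp
  left_distrib x y z := by ext <;> simp <;> ring
  right_distrib x y z := by ext <;> simp <;> ring
  zero_mul x := by ext <;> simp
  mul_zero x := by ext <;> simp
  mul_assoc x y z := by ext <;> simp <;> ring
  one_mul x := by ext <;> simp
  mul_one x := by ext <;> simp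
  nsmul := nsmulRec
  zsmul := zsmulRec

/-- The embedding of the coefficient ring. -/
def C : F →+* TruncSkewPoly F σ where
  toFun a := ⟨a, 0⟩
  map_one' := rfl
  map_zero' := rfl
  map_mul' a b := by ext <;> simp
  map_add' a b := by ext <;> simp

/-- The class of the indeterminate. -/
def X : TruncSkewPoly F σ := ⟨0, 1⟩

theorem X_mul_X : (X : TruncSkewPoly F σ) * X = 0 := by ext <;> simp [X]

theorem X_mul_C (a : F) : (X : TruncSkewPoly F σ) * C a = C (σ a) * X := by
  ext <;> simp [X, C]

theorem eq_C_add_C_mul_X (x : TruncSkewPoly F σ) : x = C x.c0 + C x.c1 * X := by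
  ext <;> simp [X, C]

/-- The universal property of `F[X; σ]/(X²)`. -/
theorem existsUnique_lift {A : Type*} [Ring A] (f : F →+* A) (t : A) (ht : t * t = 0)
    (hf : ∀ a, t * f a = f (σ a) * t) :
    ∃! g : TruncSkewPoly F σ →+* A, g.comp C = f ∧ g X = t := by
  refine ⟨{ toFun := fun x => f x.c0 + f x.c1 * t
            map_one' := by simp
            map_zero' := by simp
            map_add' := fun x y => by simp [add_mul]; abel
            map_mul' := fun x y => ?_ }, ⟨?_, ?_⟩, ?_⟩
  · have h1 : f x.c1 * t * f y.c0 = f x.c1 * f (σ y.c0) * t := by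
      rw [mul_assoc, hf, mul_assoc]
    have h2 : f x.c1 * t * (f y.c1 * t) = 0 := by
      rw [mul_assoc, ← mul_assoc t, hf, mul_assoc (f (σ y.c1)), ht, mul_zero, mul_zero]
    simp only [mul_c0, mul_c1, map_mul, map_add, add_mul, mul_add, h1, h2, add_zero]
    simp only [mul_assoc]
    abel
  · ext a
    simp [C]
  · simp [X]
  · rintro g ⟨hg, hX⟩
    ext x
    have hC : ∀ a, g (C a) = f a := fun a => by rw [← hg]; rfl
    conv_lhs => rw [eq_C_add_C_mul_X x]
    simp [hC, hX]

instance [Finite F] : Finite (TruncSkewPoly F σ) :=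
  Finite.of_injective (fun x => (x.c0, x.c1)) fun x y h => by
    simp only [Prod.mk.injEq] at h
    exact TruncSkewPoly.ext h.1 h.2

end TruncSkewPoly

/-- The Galois ring `𝔾₄ = ℤ₄[X]/(X² + X + 1)` of order `16` and characteristic `4`. -/
abbrev G4 : Type := AdjoinRoot (Polynomial.X ^ 2 + Polynomial.X + 1 : Polynomial (ZMod 4))

/-- The ring `𝕊₄ = 𝔽₄[X]/(X²)`. -/
abbrev S4 : Type := TruncSkewPoly (GaloisField 2 2) (RingHom.id (GaloisField 2 2))

/-- The ring `𝕋₄ = 𝔽₄[X; a ↦ a²]/(X²)`. -/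
abbrev T4 : Type := TruncSkewPoly (GaloisField 2 2) (frobenius (GaloisField 2 2) 2)

instance : Finite G4 := by
  have hm : (Polynomial.X ^ 2 + Polynomial.X + 1 : Polynomial (ZMod 4)).Monic := by monicity!
  have : Module.Finite (ZMod 4) G4 := hm.finite_adjoinRoot
  exact Module.finite_of_finite (ZMod 4)

namespace PHG

/-- A right `R`-submodule of the free right `R`-module `R³` (right modules over `R` are modules
over `Rᵐᵒᵖ`) is free of rank `r` if it has a basis with `r` elements. -/
def IsFreeOfRank {R : Type*} [Ring R] (r : ℕ) (N : Submodule Rᵐᵒᵖ (Fin 3 → R)) : Prop :=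
  Nonempty (Module.Basis (Fin r) Rᵐᵒᵖ N)

/-- The points of `PHG(2, R)`: the free rank `1` submodules of the right module `R³`. -/
def Point (R : Type*) [Ring R] : Type _ :=
  {N : Submodule Rᵐᵒᵖ (Fin 3 → R) // IsFreeOfRank 1 N}

/-- The lines of `PHG(2, R)`: the free rank `2` submodules of the right module `R³`. -/
def Line (R : Type*) [Ring R] : Type _ :=
  {N : Submodule Rᵐᵒᵖ (Fin 3 → R) // IsFreeOfRank 2 N}

/-- Incidence in `PHG(2, R)` is set inclusion. -/
def Incident {R : Type*} [Ring R] (x : Point R) (L : Line R) : Prop :=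
  x.1 ≤ L.1

/-- The multiplicity of a line in a multiset of points. -/
noncomputable def lineMult {R : Type*} [Ring R] (K : Multiset (Point R)) (L : Line R) : ℕ :=
  open Classical in K.countP (fun x => Incident x L)

/-- A `(k, n)`-arc in `PHG(2, R)`: a multiset of `k` points such that every line has
multiplicity at most `n`. -/
def IsArc {R : Type*} [Ring R] (k n : ℕ) (K : Multiset (Point R)) : Prop :=
  K.card = k ∧ ∀ L : Line R, lineMult K L ≤ n

/-- A multiset of points is projective if all its multiplicities are `0` or `1`. -/
def IsProjective {R : Type*} [Ring R] (K : Multiset (Point R)) : Prop :=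
  K.Nodup

/-- `m n R` is the largest size `k` for which a projective `(k, n)`-arc in `PHG(2, R)` exists. -/
noncomputable def m (n : ℕ) (R : Type*) [Ring R] : ℕ :=
  sSup {k : ℕ | ∃ K : Multiset (Point R), IsProjective K ∧ IsArc k n K}

instance {R : Type*} [Ring R] [Finite R] : Finite (Point R) :=
  Finite.of_injective (fun x : Point R => (x.1 : Set (Fin 3 → R)))
    fun _ _ h => Subtype.ext (SetLike.coe_injective h)

/-- For a finite ring the supremum in the definition of `m` is a maximum. -/
theorem isGreatest_m (n : ℕ) (R : Type*) [Ring R] [Finite R] :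
    IsGreatest {k : ℕ | ∃ K : Multiset (Point R), IsProjective K ∧ IsArc k n K} (m n R) := by
  have hne : {k : ℕ | ∃ K : Multiset (Point R), IsProjective K ∧ IsArc k n K}.Nonempty :=
    ⟨0, 0, Multiset.nodup_zero, rfl, fun L => by simp [lineMult]⟩
  have hbd : BddAbove {k : ℕ | ∃ K : Multiset (Point R), IsProjective K ∧ IsArc k n K} := by
    have := Fintype.ofFinite (Point R)
    refine ⟨Fintype.card (Point R), ?_⟩
    rintro k ⟨K, hK, rfl, -⟩
    exact Finset.card_le_univ (⟨K, hK⟩ : Finset (Point R))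
  exact ⟨Nat.sSup_mem hne hbd, fun k hk => le_csSup hbd hk⟩

end PHG

/-! All three rings are chain rings of length two with residue field of order 4. Modulo the radical
the plane becomes PG(2,4): its 21 points and 21 lines are neighbour classes of 16 points and 16
lines. Inside a point class the line segments form an affine plane of order 4, and dually inside a
line class. The upper bound uses only this structure (`IsNetPlane`), so it covers all three rings at
once.

Let K be an arc of size 84, u(x) the multiplicity of the point class x, and T(a) the sum of K(L)(6 -
K(L)) over the lines L of the class a. Counting gives ∑ T = 1680 - 3 ∑ u², which is at most 672 = 21
· 32 because ∑ u = 84. Conversely T(a) ≥ 32 as soon as four of the classes on a have u = 4 (or three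
have u = 4 and one has u = 3). The values u > 6 violate a second moment bound (`cls_le_six`). A
class with u = 6 or u = 5 forces so many classes of multiplicity 3 or 4 on the surrounding lines
that ∑ T becomes too large (`ne_six`, `ne_five`). Hence u = 4 everywhere, T = 32 everywhere, and
every line has multiplicity 2 or 6 (`lineMult_eq`).

An arc of size 85 would remain an 84-arc after deleting any one point, so its class multiplicities
would be 4 except for a 5 at the class of the deleted point. All points would then share one class,
which is absurd (`IsNetPlane.card_le`).

For 𝕊₄ and 𝕋₄ the residue field embeds in the ring. The 21 lines with coefficients in the field, one
per class, cover every point 1 or 5 times. Counting incidences of K with them modulo 4 gives 84 ≡ 0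
on one side and 21 · 2 ≡ 2 on the other (`IsNetPlane.card_lt`). Over 𝔾₄ the Teichmüller
representatives are not closed under addition, and this argument is unavailable. -/

/-- A family of five parallel classes on a set of sixteen elements, i.e. an affine plane of
order `4`: `τ i b` is the label of the line of the `i`-th parallel class through `b`. -/
structure IsAffineNet {ι B F : Type*} [Fintype ι] [Fintype B] [Fintype F] (τ : ι → B → F) :
    Prop where
  card_index : Fintype.card ι = 5
  card_points : Fintype.card B = 16
  card_labels : Fintype.card F = 4
  injective : ∀ i j, i ≠ j → Function.Injective fun b => (τ i b, τ j b)

/-! ### Counting in an affine plane of order 4. -/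

open Finset

namespace IsAffineNet

variable {ι B F : Type*} [Fintype ι] [Fintype B] [Fintype F] [DecidableEq ι] [DecidableEq B]
  [DecidableEq F] {τ : ι → B → F}

set_option linter.unusedSectionVars false

theorem comp_equiv {κ : Type*} [Fintype κ] (h : IsAffineNet τ) (e : κ ≃ ι) :
    IsAffineNet fun i => τ (e i) where
  card_index := (Fintype.card_congr e).trans h.card_index
  card_points := h.card_points
  card_labels := h.card_labels
  injective _ _ hij := h.injective _ _ (e.injective.ne hij)

theorem bijective (h : IsAffineNet τ) {i j : ι} (hij : i ≠ j) :
    Function.Bijective fun b => (τ i b, τ j b) := by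
  refine (Fintype.bijective_iff_injective_and_card _).2 ⟨h.injective i j hij, ?_⟩
  rw [Fintype.card_prod, h.card_points, h.card_labels]

theorem exists_ne (h : IsAffineNet τ) (i : ι) : ∃ j, j ≠ i := by
  have : Nontrivial ι := Fintype.one_lt_card_iff_nontrivial.1 (by rw [h.card_index]; norm_num)
  exact _root_.exists_ne i

theorem sum_pair (h : IsAffineNet τ) {i j : ι} (hij : i ≠ j) (g : F → F → ℤ) :
    ∑ b, g (τ i b) (τ j b) = ∑ s, ∑ t, g s t := by
  rw [← Fintype.sum_prod_type']
  exact (h.bijective hij).sum_comp (fun p : F × F => g p.1 p.2)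

theorem sum_row (h : IsAffineNet τ) {i j : ι} (hij : i ≠ j) (s : F) (g : F → ℤ) :
    ∑ b with τ i b = s, g (τ j b) = ∑ t, g t := by
  rw [sum_filter, h.sum_pair hij (fun a t => if a = s then g t else 0), Finset.sum_comm]
  simp

theorem card_row (h : IsAffineNet τ) (i : ι) (s : F) : #{b | τ i b = s} = 4 := by
  obtain ⟨j, hj⟩ := h.exists_ne i
  have := h.sum_row hj.symm s (fun _ => 1)
  simp only [sum_const, card_univ, h.card_labels] at this
  rw [nsmul_one, nsmul_one] at this
  exact_mod_cast this

theorem sum_single (h : IsAffineNet τ) (i : ι) (g : F → ℤ) :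
    ∑ b, g (τ i b) = 4 * ∑ t, g t := by
  obtain ⟨j, hj⟩ := h.exists_ne i
  rw [h.sum_pair hj.symm (fun s _ => g s), mul_sum]
  simp [h.card_labels]

theorem sum_mul (h : IsAffineNet τ) {i j : ι} (hij : i ≠ j) (f g : F → ℤ) :
    ∑ b, f (τ i b) * g (τ j b) = (∑ t, f t) * ∑ t, g t := by
  rw [h.sum_pair hij (fun s t => f s * g t), sum_mul_sum]

/-- Injectivity gives at most one agreement. Summed over all `c` there are 5 · 4 = 20 agreements, 5
of them with `c = b`; the remaining 15 are spread over 15 elements, so each bound is attained. -/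
theorem card_agree (h : IsAffineNet τ) {b c : B} (hbc : b ≠ c) : #{i | τ i b = τ i c} = 1 := by
  have hle : ∀ c ∈ univ.erase b, #{i | τ i b = τ i c} ≤ 1 := by
    intro c hc
    refine card_le_one.2 fun i hi j hj => by_contra fun hij => ?_
    simp only [mem_filter, mem_univ, true_and] at hi hj
    exact (ne_of_mem_erase hc) (h.injective i j hij (Prod.ext hi.symm hj.symm))
  have htot : ∑ c ∈ univ.erase b, #{i | τ i b = τ i c} = ∑ c ∈ univ.erase b, 1 := by
    have h1 : ∑ c, #{i | τ i b = τ i c} = 20 := by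
      simp_rw [card_filter]
      rw [sum_comm]
      simp_rw [← card_filter]
      have : ∀ i, #{c | τ i b = τ i c} = 4 := fun i => by
        simpa [eq_comm] using h.card_row i (τ i b)
      simp [this, h.card_index]
    rw [← add_sum_erase _ _ (mem_univ b)] at h1
    simp only [filter_true, card_univ, h.card_index, sum_const, card_erase_of_mem (mem_univ b),
      h.card_points] at h1 ⊢
    simp at *
    omega
  exact (sum_eq_sum_iff_of_le hle).1 htot c (by simp [hbc.symm])

/-- The multiplicity of `b` when the line labelled `t` in the `i`-th parallel class has
weight `w i t`. -/
def mult (τ : ι → B → F) (w : ι → F → ℤ) (b : B) : ℤ := ∑ i, w i (τ i b)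

/-- The four elements of a row share one label in class `i` and run through all four labels of every
other class. -/
theorem sum_row_mult (h : IsAffineNet τ) (w : ι → F → ℤ) (i : ι) (s : F) :
    ∑ b with τ i b = s, mult τ w b = 3 * w i s + (w i s - ∑ t, w i t) + ∑ j, ∑ t, w j t := by
  simp only [mult]
  rw [sum_comm, ← add_sum_erase _ _ (mem_univ i), ← add_sum_erase (a := i) (s := univ)
    (fun j => ∑ t, w j t) (mem_univ i)]
  have h1 : ∑ b with τ i b = s, w i (τ i b) = 4 * w i s := by
    rw [sum_congr rfl (g := fun _ => w i s) fun b hb => by rw [(mem_filter.1 hb).2], sum_const,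
      h.card_row]
    simp
  have h2 : ∑ j ∈ univ.erase i, ∑ b with τ i b = s, w j (τ j b)
      = ∑ j ∈ univ.erase i, ∑ t, w j t :=
    sum_congr rfl fun j hj => h.sum_row (ne_of_mem_erase hj).symm s _
  rw [h1, h2]
  ring

theorem sum_mult (h : IsAffineNet τ) (w : ι → F → ℤ) :
    ∑ b, mult τ w b = 4 * ∑ i, ∑ t, w i t := by
  simp only [mult]
  rw [sum_comm, mul_sum]
  exact sum_congr rfl fun i _ => h.sum_single i _

/-- Expand the square: two different classes are independent, so their mixed terms factor into
products of sums, while each diagonal term counts every label four times. -/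
theorem sum_mult_sq (h : IsAffineNet τ) (w : ι → F → ℤ) :
    ∑ b, mult τ w b ^ 2 = 4 * ∑ i, ∑ t, w i t ^ 2 + (∑ i, ∑ t, w i t) ^ 2
      - ∑ i, (∑ t, w i t) ^ 2 := by
  have h1 : ∀ i, ∑ j, ∑ b, w i (τ i b) * w j (τ j b)
      = 4 * ∑ t, w i t ^ 2 + ((∑ t, w i t) * ∑ j, ∑ t, w j t - (∑ t, w i t) ^ 2) := by
    intro i
    rw [← add_sum_erase _ _ (mem_univ i), ← add_sum_erase (a := i) (s := univ)
      (fun j => ∑ t, w j t) (mem_univ i)]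
    rw [sum_congr rfl fun j hj => h.sum_mul (ne_of_mem_erase hj).symm (w i) (w j), ← mul_sum]
    have := h.sum_single i (fun t => w i t * w i t)
    rw [this]
    simp only [← pow_two]
    ring
  have h2 : ∀ b, mult τ w b ^ 2 = ∑ i, ∑ j, w i (τ i b) * w j (τ j b) := fun b => by
    rw [mult, pow_two, sum_mul_sum]
  rw [sum_congr rfl fun b _ => h2 b, sum_comm]
  rw [sum_congr rfl fun i _ => sum_comm]
  rw [sum_congr rfl fun i _ => h1 i, sum_add_distrib, sum_sub_distrib, ← mul_sum, ← Finset.sum_mul]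
  ring

/-- Counting pairs of elements of `S` on a common line. -/
theorem sum_card_sq (h : IsAffineNet τ) (S : Finset B) :
    ∑ i, ∑ t, (#{b ∈ S | τ i b = t} : ℤ) ^ 2 = (#S : ℤ) ^ 2 + 4 * #S := by
  have h1 : ∀ i, ∑ t, (#{b ∈ S | τ i b = t} : ℤ) ^ 2
      = ∑ b ∈ S, ∑ c ∈ S, if τ i b = τ i c then (1 : ℤ) else 0 := by
    intro i
    have : ∀ t, (#{b ∈ S | τ i b = t} : ℤ) ^ 2
        = ∑ b ∈ S, ∑ c ∈ S, (if τ i b = t then (1 : ℤ) else 0) * if τ i c = t then 1 else 0 := by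
      intro t
      rw [pow_two, card_filter]
      push_cast
      rw [sum_mul_sum]
    rw [sum_congr rfl fun t _ => this t, sum_comm]
    refine sum_congr rfl fun b _ => ?_
    rw [sum_comm]
    refine sum_congr rfl fun c _ => ?_
    simp only [ite_mul, one_mul, zero_mul, sum_ite_eq, mem_univ, if_true]
    simp [eq_comm]
  have h2 : ∀ b c, ∑ i, (if τ i b = τ i c then (1 : ℤ) else 0) = if b = c then 5 else 1 := by
    intro b c
    split_ifs with hbc
    · subst hbc
      simp [h.card_index]
    · have := h.card_agree hbc
      rw [card_filter] at this
      exact_mod_cast this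
  rw [sum_congr rfl fun i _ => h1 i, sum_comm]
  have h3 : ∀ b ∈ S, ∑ i, ∑ c ∈ S, (if τ i b = τ i c then (1 : ℤ) else 0) = #S + 4 := by
    intro b hb
    rw [sum_comm, sum_congr rfl fun c _ => h2 b c]
    have : ∀ c, (if b = c then (5 : ℤ) else 1) = 1 + if b = c then 4 else 0 := fun c => by
      split_ifs <;> norm_num
    simp [this, sum_add_distrib, hb]
  rw [sum_congr rfl h3]
  simp
  ring

end IsAffineNet

/-! ### Extremal values of sums of quadratic terms. -/

/-- The least value of `∑ d (6 - d)` over tuples of integers `0 ≤ d ≤ 6` with sum `s`. -/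
def sixDefect (s : ℤ) : ℤ := (s % 6) * (6 - s % 6)

theorem sixDefect_add_le (s d : ℤ) (h0 : 0 ≤ d) (h6 : d ≤ 6) :
    sixDefect (d + s) ≤ d * (6 - d) + sixDefect s := by
  unfold sixDefect
  have h1 : (d + s) % 6 = (d + s % 6) % 6 := by omega
  have h2 : 0 ≤ s % 6 := by omega
  have h3 : s % 6 < 6 := by omega
  rw [h1]
  generalize s % 6 = r at *
  interval_cases d <;> interval_cases r <;> decide

theorem sixDefect_sum_le {B : Type*} (S : Finset B) (d : B → ℤ)
    (h : ∀ b ∈ S, 0 ≤ d b ∧ d b ≤ 6) : sixDefect (∑ b ∈ S, d b) ≤ ∑ b ∈ S, d b * (6 - d b) := by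
  classical
  induction S using Finset.induction_on with
  | empty => simp [sixDefect]
  | insert b S hb ih =>
    rw [sum_insert hb, sum_insert hb]
    have h1 := ih fun c hc => h c (mem_insert_of_mem hc)
    have h2 := h b (mem_insert_self b S)
    have h3 := sixDefect_add_le (∑ b ∈ S, d b) (d b) h2.1 h2.2
    linarith

/-- The largest value of `∑ w t ^ 2` when `∑ w t = u` and all `0 ≤ w t ≤ M`. -/
def sqBound (u M : ℤ) : ℤ := (u / M) * M ^ 2 + (u % M) ^ 2

theorem sq_add_sqBound_le (s d M : ℤ) (h0 : 0 ≤ d) (hM : d ≤ M) (hs : 0 ≤ s) :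
    d ^ 2 + sqBound s M ≤ sqBound (d + s) M := by
  unfold sqBound
  obtain rfl | hM0 := eq_or_ne M 0
  · obtain rfl : d = 0 := by omega
    simp
  have hMp : 0 < M := by omega
  have h1 := Int.emod_nonneg s hM0
  have h2 := Int.emod_lt_of_pos s hMp
  have h3 := Int.mul_ediv_add_emod s M
  generalize s % M = r at *
  generalize s / M = k at *
  subst h3
  obtain h | h := lt_or_ge (d + r) M
  · have e1 : (d + (M * k + r)) / M = k := by
      rw [show d + (M * k + r) = d + r + M * k by ring, Int.add_mul_ediv_left _ _ hM0,
        Int.ediv_eq_zero_of_lt (by omega) h, zero_add]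
    have e2 : (d + (M * k + r)) % M = d + r := by
      rw [show d + (M * k + r) = d + r + M * k by ring, Int.add_mul_emod_self_left,
        Int.emod_eq_of_lt (by omega) h]
    rw [e1, e2]
    nlinarith [mul_nonneg h0 h1]
  · have e1 : (d + (M * k + r)) / M = k + 1 := by
      rw [show d + (M * k + r) = d + r - M + M * (k + 1) by ring, Int.add_mul_ediv_left _ _ hM0,
        Int.ediv_eq_zero_of_lt (by omega) (by omega), zero_add]
    have e2 : (d + (M * k + r)) % M = d + r - M := by
      rw [show d + (M * k + r) = d + r - M + M * (k + 1) by ring, Int.add_mul_emod_self_left,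
        Int.emod_eq_of_lt (by omega) (by omega)]
    rw [e1, e2]
    -- The gain M² + (d + r - M)² - d² - r² equals 2 (M - d)(M - r).
    nlinarith [mul_nonneg (sub_nonneg.2 hM) (sub_nonneg.2 h2.le)]

theorem sum_sq_le_sqBound {F : Type*} (S : Finset F) (w : F → ℤ) (M : ℤ)
    (h : ∀ t ∈ S, 0 ≤ w t ∧ w t ≤ M) : ∑ t ∈ S, w t ^ 2 ≤ sqBound (∑ t ∈ S, w t) M := by
  classical
  induction S using Finset.induction_on with
  | empty => simp [sqBound]
  | insert b S hb ih =>
    rw [sum_insert hb, sum_insert hb]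
    have h1 := ih fun c hc => h c (mem_insert_of_mem hc)
    have h2 := h b (mem_insert_self b S)
    have h3 := sq_add_sqBound_le (∑ b ∈ S, w b) (w b) M h2.1 h2.2
      (sum_nonneg fun c hc => (h c (mem_insert_of_mem hc)).1)
    linarith

/-! ### A single neighbour class of lines and its defect. -/

/-- The affine net `τ` describes the sixteen lines of a neighbour class of lines, the index `i`
being one of the five neighbour classes of points on it. The line segments of that point class
have multiplicities `w i t`, and all lines have multiplicity at most `6`. -/
structure IsLineClass {ι B F : Type*} [Fintype ι] [Fintype B] [Fintype F] (τ : ι → B → F)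
    (w : ι → F → ℤ) : Prop where
  net : IsAffineNet τ
  nonneg : ∀ i t, 0 ≤ w i t
  mult_le : ∀ b, IsAffineNet.mult τ w b ≤ 6

namespace IsLineClass

variable {ι B F : Type*} [Fintype ι] [Fintype B] [Fintype F] [DecidableEq ι] [DecidableEq B]
  [DecidableEq F] {τ : ι → B → F} {w : ι → F → ℤ}

set_option linter.unusedSectionVars false

/-- The multiplicity of a neighbour class of points. -/
def classMult (w : ι → F → ℤ) (i : ι) : ℤ := ∑ t, w i t

/-- The multiplicity of a neighbour class of lines. -/
def totalMult (w : ι → F → ℤ) : ℤ := ∑ i, classMult w i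

/-- The sum of `K(L) (6 - K(L))` over the lines `L` of the class. -/
def defect (τ : ι → B → F) (w : ι → F → ℤ) : ℤ :=
  ∑ b, (6 - IsAffineNet.mult τ w b) * (6 - (6 - IsAffineNet.mult τ w b))

theorem mult_nonneg (h : IsLineClass τ w) (b : B) : 0 ≤ IsAffineNet.mult τ w b :=
  sum_nonneg fun _ _ => h.nonneg _ _

theorem defect_nonneg (h : IsLineClass τ w) : 0 ≤ defect τ w :=
  sum_nonneg fun b _ => mul_nonneg (by linarith [h.mult_le b]) (by linarith [h.mult_nonneg b])

theorem sum_row_sub (h : IsLineClass τ w) (i : ι) (s : F) :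
    ∑ b with τ i b = s, (6 - IsAffineNet.mult τ w b)
      = 24 + classMult w i - totalMult w - 4 * w i s := by
  rw [sum_sub_distrib, h.net.sum_row_mult, sum_const, h.net.card_row, totalMult]
  simp only [classMult]
  norm_num
  ring

theorem weight_le (h : IsLineClass τ w) (i : ι) (s : F) :
    4 * w i s ≤ 24 + classMult w i - totalMult w := by
  have h1 := h.sum_row_sub i s
  have h2 : 0 ≤ ∑ b with τ i b = s, (6 - IsAffineNet.mult τ w b) :=
    sum_nonneg fun b _ => by linarith [h.mult_le b]
  linarith

theorem sum_sub (h : IsLineClass τ w) :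
    ∑ b, (6 - IsAffineNet.mult τ w b) = 96 - 4 * totalMult w := by
  rw [sum_sub_distrib, h.net.sum_mult, sum_const, card_univ, h.net.card_points, totalMult]
  simp only [classMult]
  norm_num

theorem defect_eq (h : IsLineClass τ w) :
    defect τ w = 24 * totalMult w - totalMult w ^ 2
      + ∑ i, (classMult w i ^ 2 - 4 * ∑ t, w i t ^ 2) := by
  have h1 : defect τ w = 6 * ∑ b, IsAffineNet.mult τ w b - ∑ b, IsAffineNet.mult τ w b ^ 2 := by
    rw [mul_sum, ← sum_sub_distrib]
    exact sum_congr rfl fun b _ => by ring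
  rw [h1, h.net.sum_mult, h.net.sum_mult_sq, sum_sub_distrib, ← mul_sum, totalMult]
  simp only [classMult]
  ring

theorem sum_sq_le (h : IsLineClass τ w) (i : ι) :
    ∑ t, w i t ^ 2 ≤ sqBound (classMult w i) ((24 + classMult w i - totalMult w) / 4) :=
  sum_sq_le_sqBound _ _ _ fun t _ => ⟨h.nonneg i t, by have := h.weight_le i t; omega⟩

/-- The lines other than `b₀` are partitioned by the line segment that they share with `b₀`. -/
theorem sum_eq_add_sum_rows (h : IsAffineNet τ) (f : B → ℤ) (b₀ : B) :
    ∑ b, f b = f b₀ + ∑ i, ∑ b ∈ ({b | τ i b = τ i b₀} : Finset B).erase b₀, f b := by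
  rw [← add_sum_erase _ _ (mem_univ b₀)]
  congr 1
  have h1 : ∀ i, ∑ b ∈ ({b | τ i b = τ i b₀} : Finset B).erase b₀, f b
      = ∑ b ∈ univ.erase b₀, if τ i b = τ i b₀ then f b else 0 := by
    intro i
    rw [← sum_filter]
    congr 1
    ext b
    simp [and_comm]
  rw [sum_congr rfl fun i _ => h1 i, sum_comm]
  refine sum_congr rfl fun b hb => ?_
  rw [← sum_filter, sum_const, h.card_agree (ne_of_mem_erase hb), one_smul]

theorem sum_erase_row_sub (h : IsLineClass τ w) (i : ι) (b₀ : B) :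
    ∑ b ∈ ({b | τ i b = τ i b₀} : Finset B).erase b₀, (6 - IsAffineNet.mult τ w b)
      = 18 + classMult w i - totalMult w - 4 * w i (τ i b₀) + IsAffineNet.mult τ w b₀ := by
  have h1 := h.sum_row_sub i (τ i b₀)
  rw [← add_sum_erase _ _ (show b₀ ∈ ({b | τ i b = τ i b₀} : Finset B) by simp)] at h1
  linarith

/-- The other fifteen lines fall into five triples, according to the segment shared with `b₀`. The
total deficiency of each triple is known, so it has a nonnegative value and `sixDefect` bounds the
defect of the triple from below. -/
theorem star_bound (h : IsLineClass τ w) (b₀ : B) :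
    (∀ i, 0 ≤ 18 + classMult w i - totalMult w - 4 * w i (τ i b₀) + IsAffineNet.mult τ w b₀) ∧
    (6 - IsAffineNet.mult τ w b₀) * (6 - (6 - IsAffineNet.mult τ w b₀)) +
      ∑ i, sixDefect
        (18 + classMult w i - totalMult w - 4 * w i (τ i b₀) + IsAffineNet.mult τ w b₀)
      ≤ defect τ w := by
  constructor
  · intro i
    rw [← h.sum_erase_row_sub i b₀]
    exact sum_nonneg fun b _ => by linarith [h.mult_le b]
  · rw [defect, sum_eq_add_sum_rows h.net _ b₀]
    refine add_le_add le_rfl (sum_le_sum fun i _ => ?_)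
    rw [← h.sum_erase_row_sub i b₀]
    exact sixDefect_sum_le _ _ fun b _ => ⟨by linarith [h.mult_le b], by linarith [h.mult_nonneg b]⟩

/-- If all multiplicities m are at least 2, then m (6 - m) ≥ 2 (6 - m) can be summed. Otherwise
apply `star_bound` to a line of multiplicity 0 or 1: its five segments all have weight 0,
respectively all but one, which has weight 1. -/
theorem defect_cases (h : IsLineClass τ w) :
    ((∀ b, 2 ≤ IsAffineNet.mult τ w b) ∧ 192 - 8 * totalMult w ≤ defect τ w) ∨
    ((∀ i, 0 ≤ 18 + classMult w i - totalMult w) ∧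
      ∑ i, sixDefect (18 + classMult w i - totalMult w) ≤ defect τ w) ∨
    ∃ j, (∀ i, 0 ≤ 19 + classMult w i - totalMult w - 4 * if i = j then 1 else 0) ∧
      5 + ∑ i, sixDefect (19 + classMult w i - totalMult w - 4 * if i = j then 1 else 0)
        ≤ defect τ w := by
  by_cases h2 : ∀ b, 2 ≤ IsAffineNet.mult τ w b
  · refine Or.inl ⟨h2, ?_⟩
    have : 2 * ∑ b, (6 - IsAffineNet.mult τ w b) ≤ defect τ w := by
      rw [mul_sum]
      refine sum_le_sum fun b _ => ?_
      nlinarith [h2 b, h.mult_le b]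
    rw [h.sum_sub] at this
    linarith
  refine Or.inr ?_
  push Not at h2
  obtain ⟨b, hb⟩ := h2
  have hs := h.star_bound b
  have hw : ∀ i, w i (τ i b) ≤ IsAffineNet.mult τ w b := fun i =>
    single_le_sum (f := fun i => w i (τ i b)) (fun i _ => h.nonneg i _) (mem_univ i)
  obtain h0 | h1 : IsAffineNet.mult τ w b = 0 ∨ IsAffineNet.mult τ w b = 1 := by
    have := h.mult_nonneg b
    omega
  · have hw0 : ∀ i, w i (τ i b) = 0 := fun i => le_antisymm (h0 ▸ hw i) (h.nonneg i _)
    simp only [hw0, h0] at hs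
    left
    simpa using hs
  · right
    have hex : ∃ j, w j (τ j b) ≠ 0 := by
      by_contra hne
      push Not at hne
      simp [IsAffineNet.mult, hne] at h1
    obtain ⟨j, hj⟩ := hex
    have hw1 : ∀ i, w i (τ i b) = if i = j then 1 else 0 := by
      have hj1 : w j (τ j b) = 1 := by
        have := hw j
        have := h.nonneg j (τ j b)
        omega
      have hrest : ∑ i ∈ univ.erase j, w i (τ i b) = 0 := by
        have := add_sum_erase univ (fun i => w i (τ i b)) (mem_univ j)
        simp only [IsAffineNet.mult] at h1
        omega
      intro i
      split_ifs with hij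
      · rw [hij, hj1]
      · exact (sum_eq_zero_iff_of_nonneg fun i _ => h.nonneg i _).1 hrest i (by simp [hij])
    simp only [hw1, h1] at hs
    refine ⟨j, fun i => by linarith [hs.1 i], ?_⟩
    refine le_trans (le_of_eq ?_) hs.2
    congr 1
    exact sum_congr rfl fun i _ => by congr 1; ring

end IsLineClass

/-- A sum of values of `sixDefect`, with the value `1000` for inadmissible arguments. -/
def sixDefectSum (s : Fin 5 → ℤ) : ℤ :=
  -- The value 1000 plays the role of infinity: a case with a negative argument cannot occur and
  -- must not lower the minimum in `defectBound`.
  if ∀ i, 0 ≤ s i then ∑ i, sixDefect (s i) else 1000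

/-- A lower bound for the defect of a class of lines through point classes of multiplicities
`v i`. -/
def defectBound (v : Fin 5 → ℤ) : ℤ :=
  -- The first bound is `defect_eq` with the sums of squares as large as `weight_le` permits; the
  -- minimum runs over the alternatives of `defect_cases`.
  max (24 * (∑ i, v i) - (∑ i, v i) ^ 2
      + ∑ i, (v i ^ 2 - 4 * sqBound (v i) ((24 + v i - ∑ i, v i) / 4)))
    (min (192 - 8 * ∑ i, v i) (min (sixDefectSum fun i => 18 + v i - ∑ i, v i)
      (univ.inf' univ_nonempty fun j => 5 + sixDefectSum fun i =>
        19 + v i - (∑ i, v i) - 4 * if i = j then 1 else 0)))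

theorem IsLineClass.defectBound_le {B F : Type*} [Fintype B] [Fintype F] [DecidableEq B]
    [DecidableEq F] {τ : Fin 5 → B → F} {w : Fin 5 → F → ℤ} (h : IsLineClass τ w) :
    defectBound (classMult w) ≤ defect τ w := by
  refine max_le ?_ ?_
  · rw [h.defect_eq, ← totalMult]
    refine add_le_add le_rfl (sum_le_sum fun i _ => ?_)
    linarith [h.sum_sq_le i]
  · rw [← totalMult]
    obtain h1 | h1 | ⟨j, h1⟩ := h.defect_cases
    · exact (min_le_left _ _).trans h1.2
    · refine (min_le_right _ _).trans ((min_le_left _ _).trans ?_)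
      rw [sixDefectSum, if_pos h1.1]
      exact h1.2
    · refine (min_le_right _ _).trans ((min_le_right _ _).trans ((inf'_le _ (mem_univ j)).trans ?_))
      rw [sixDefectSum, if_pos h1.1]
      exact h1.2

/-- The value 32 is exactly the average defect 672/21 when all point classes have multiplicity 4, so
there is no slack. -/
theorem defectBound_four_fours (a : Fin 7) : 32 ≤ defectBound ![4, 4, 4, 4, a] := by
  revert a; decide

theorem defectBound_four_fours_five : 52 ≤ defectBound ![4, 4, 4, 4, 5] := by
  decide

theorem defectBound_three_fours_three (a : Fin 7) : 32 ≤ defectBound ![4, 4, 4, 3, a] := by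
  revert a; decide

theorem defectBound_three_fours_three_six : 48 ≤ defectBound ![4, 4, 4, 3, 6] := by
  decide

theorem defectBound_six (a b c d : Fin 7) (h : (a + b + c + d : ℕ) = 14) :
    15 ≤ defectBound ![6, a, b, c, d] := by
  revert a b c d; decide

/-! ### Enumerations of five-element sets. -/

/-- The map `e` enumerates the five elements of `s`. -/
structure Enumerates {α : Type*} (e : Fin 5 → α) (s : Finset α) : Prop where
  injective : Function.Injective e
  mem_iff : ∀ x, x ∈ s ↔ ∃ i, e i = x

namespace Enumerates

variable {α : Type*} {e : Fin 5 → α} {s : Finset α}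

theorem mem (h : Enumerates e s) (i : Fin 5) : e i ∈ s := (h.mem_iff _).2 ⟨i, rfl⟩

theorem sum_eq (h : Enumerates e s) (f : α → ℤ) : ∑ x ∈ s, f x = ∑ i, f (e i) := by
  classical
  have : s = univ.image e := by
    ext x
    simp [h.mem_iff]
  rw [this, sum_image fun i _ j _ hij => h.injective hij]

theorem of_injective (hs : #s = 5) (he : Function.Injective e) (hm : ∀ i, e i ∈ s) :
    Enumerates e s := by
  classical
  refine ⟨he, fun x => ⟨fun hx => ?_, ?_⟩⟩
  · have : univ.image e = s := by
      refine eq_of_subset_of_card_le (fun x hx => ?_) ?_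
      · obtain ⟨i, -, rfl⟩ := mem_image.1 hx
        exact hm i
      · rw [card_image_of_injective _ he, hs]
        simp
    rw [← this] at hx
    simpa using hx
  · rintro ⟨i, rfl⟩
    exact hm i

theorem comp (h : Enumerates e s) (σ : Equiv.Perm (Fin 5)) : Enumerates (e ∘ σ) s where
  injective := h.injective.comp σ.injective
  mem_iff x := by
    rw [h.mem_iff]
    exact ⟨fun ⟨i, hi⟩ => ⟨σ.symm i, by simpa using hi⟩, fun ⟨i, hi⟩ => ⟨σ i, hi⟩⟩

theorem exists_of_card (hs : #s = 5) : ∃ e, Enumerates (α := α) e s := by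
  refine ⟨fun i => (s.equivFinOfCardEq hs).symm i, fun i j hij => ?_, fun x => ⟨fun hx => ?_, ?_⟩⟩
  · exact (s.equivFinOfCardEq hs).symm.injective (Subtype.ext hij)
  · exact ⟨s.equivFinOfCardEq hs ⟨x, hx⟩, by simp⟩
  · rintro ⟨i, rfl⟩
    exact ((s.equivFinOfCardEq hs).symm i).2

theorem exists_sorted (hs : #s = 5) (g : α → ℤ) :
    ∃ e, Enumerates (α := α) e s ∧ Antitone (g ∘ e) := by
  obtain ⟨e, he⟩ := exists_of_card hs
  refine ⟨_, he.comp (Tuple.sort fun i => -g (e i)), fun i j hij => ?_⟩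
  have := Tuple.monotone_sort (fun i => -g (e i)) hij
  simpa using this

/-- An enumeration with a prescribed last element. -/
theorem exists_last (hs : #s = 5) {x : α} (hx : x ∈ s) :
    ∃ e, Enumerates (α := α) e s ∧ e 4 = x := by
  obtain ⟨e, he⟩ := exists_of_card hs
  obtain ⟨i, hi⟩ := (he.mem_iff x).1 hx
  exact ⟨_, he.comp (Equiv.swap i 4), by simp [hi]⟩

end Enumerates

/-! ### Class multiplicities as a weight function on PG(2,4). -/

namespace ReducedArc

open Configuration

open scoped Classical

set_option linter.unusedSectionVars false

variable {X A : Type*} [Fintype X] [Fintype A] [Membership X A] [ProjectivePlane X A]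

/-- The points on a line. -/
noncomputable def pts (X : Type*) {A : Type*} [Fintype X] [Membership X A] (a : A) : Finset X :=
  {x | x ∈ a}

/-- The lines through a point. -/
noncomputable def lns {X : Type*} (A : Type*) [Fintype A] [Membership X A] (x : X) : Finset A :=
  {a | x ∈ a}

@[simp] theorem mem_pts {x : X} {a : A} : x ∈ pts X a ↔ x ∈ a := by simp [pts]

@[simp] theorem mem_lns {x : X} {a : A} : a ∈ lns A x ↔ x ∈ a := by simp [lns]

theorem card_pts (ho : ProjectivePlane.order X A = 4) (a : A) : #(pts X a) = 5 := by
  have := ProjectivePlane.pointCount_eq (P := X) a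
  rwa [ho, pointCount, Nat.card_eq_fintype_card, Fintype.card_subtype] at this

theorem card_lns (ho : ProjectivePlane.order X A = 4) (x : X) : #(lns A x) = 5 := by
  have := ProjectivePlane.lineCount_eq (L := A) x
  rwa [ho, lineCount, Nat.card_eq_fintype_card, Fintype.card_subtype] at this

theorem card_lns_inter {x y : X} (h : x ≠ y) : #(lns A x ∩ lns A y) = 1 := by
  obtain ⟨a, ha, hu⟩ := HasLines.existsUnique_line X A x y h
  rw [card_eq_one]
  refine ⟨a, ?_⟩
  ext b
  simp only [mem_inter, mem_lns, mem_singleton]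
  exact ⟨hu b, fun h => h ▸ ha⟩

theorem sum_lns_sum_pts (ho : ProjectivePlane.order X A = 4) (f : X → ℤ) (x : X) :
    ∑ a ∈ lns A x, ∑ y ∈ pts X a, f y = ∑ y, f y + 4 * f x := by
  have h1 : ∀ y, (∑ a ∈ lns A x, if y ∈ a then f y else 0) = f y + 4 * if y = x then f y else 0 := by
    intro y
    rw [← sum_filter, sum_const]
    have h2 : {a ∈ lns A x | y ∈ a} = lns A x ∩ lns A y := by
      ext a
      simp
    split_ifs with h
    · subst h
      rw [h2, inter_self, card_lns ho]
      simp
      ring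
    · rw [h2, card_lns_inter (A := A) (Ne.symm h)]
      simp
  simp only [pts, sum_filter]
  rw [sum_comm, sum_congr rfl fun y _ => h1 y, sum_add_distrib, ← mul_sum]
  simp

theorem sum_sum_pts (f : A → X → ℤ) :
    ∑ a, ∑ x ∈ pts X a, f a x = ∑ x, ∑ a ∈ lns A x, f a x := by
  simp only [pts, lns, sum_filter]
  rw [sum_comm]

/-- The perspectivity from a point `x` to a line not through `x`. -/
theorem exists_perspectivity (ho : ProjectivePlane.order X A = 4) {x : X} {f : Fin 5 → A}
    (hf : Enumerates f (lns A x)) {a : A} (hx : x ∉ a) :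
    ∃ e, Enumerates e (pts X a) ∧ ∀ i, e i ∈ f i := by
  have hfx : ∀ i, x ∈ f i := fun i => mem_lns.1 (hf.mem i)
  have hne : ∀ i, f i ≠ a := fun i h => hx (h ▸ hfx i)
  choose e he using fun i => (HasPoints.existsUnique_point X A (f i) a (hne i)).exists
  refine ⟨e, Enumerates.of_injective (card_pts ho a) (fun i j hij => ?_) fun i => by simp [he],
    fun i => (he i).1⟩
  obtain h | h := Nondegenerate.eq_or_eq (he i).1 (hfx i) (hij ▸ (he j).1) (hfx j)
  · exact absurd (h ▸ (he i).2) hx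
  · exact hf.injective h

/-- The sum of `u` over the points on a line. -/
noncomputable def lineSum (u : X → ℤ) (a : A) : ℤ := ∑ x ∈ pts X a, u x

/-- The properties of the multiplicities `u x` of the neighbour classes of points and of the
defects `T a` of the neighbour classes of lines of an `(84, 6)`-arc that determine `u`. -/
structure IsReducedArc (u : X → ℤ) (T : A → ℤ) : Prop where
  order_eq : ProjectivePlane.order X A = 4
  nonneg : ∀ x, 0 ≤ u x
  le_six : ∀ x, u x ≤ 6
  sum_eq : ∑ x, u x = 84
  sum_defect : ∑ a, T a = 1680 - 3 * ∑ x, u x ^ 2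
  defect_nonneg : ∀ a, 0 ≤ T a
  defectBound_le : ∀ a e, Enumerates e (pts X a) → defectBound (fun i => u (e i)) ≤ T a
  lineSum_le_of_five : ∀ (x : X) (a : A), x ∈ a → u x = 5 → lineSum u a ≤ 21
  lineSum_le_of_six : ∀ (x : X) (a : A), x ∈ a → u x = 6 → lineSum u a ≤ 22
  two_sixes : ∀ (x y : X) (a : A), x ∈ a → y ∈ a → x ≠ y → u x = 6 → u y = 6 →
    lineSum u a ≠ 22
  two_fives_four : ∀ (x y z : X) (a : A), x ∈ a → y ∈ a → z ∈ a → x ≠ y → u x = 5 → u y = 5 →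
    u z = 4 → lineSum u a ≠ 21
  four_fives : ∀ (a : A) (e : Fin 5 → X), Enumerates e (pts X a) →
    (∀ i, i ≠ 4 → u (e i) = 5) → lineSum u a ≠ 20 ∧ lineSum u a ≠ 21

namespace IsReducedArc

variable {u : X → ℤ} {T : A → ℤ}

theorem sum_lineSum (h : IsReducedArc u T) (x : X) :
    ∑ a ∈ lns A x, lineSum u a = 84 + 4 * u x := by
  simp only [lineSum]
  rw [sum_lns_sum_pts h.order_eq, h.sum_eq]

theorem lineSum_eq {a : A} {e : Fin 5 → X} (he : Enumerates e (pts X a)) :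
    lineSum u a = u (e 0) + u (e 1) + u (e 2) + u (e 3) + u (e 4) := by
  rw [lineSum, he.sum_eq, Fin.sum_univ_five]

theorem card_lines (h : IsReducedArc u T) : Fintype.card A = 21 := by
  have := ProjectivePlane.card_lines X A
  rw [this, h.order_eq]
  norm_num

theorem card_points (h : IsReducedArc u T) : Fintype.card X = 21 := by
  have := ProjectivePlane.card_points X A
  rw [this, h.order_eq]
  norm_num

theorem sum_sub_four_sq (h : IsReducedArc u T) :
    ∑ x, (u x - 4) ^ 2 = ∑ x, u x ^ 2 - 336 := by
  have : ∀ x, (u x - 4) ^ 2 = u x ^ 2 - 8 * u x + 16 := fun x => by ring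
  simp only [this, sum_add_distrib, sum_sub_distrib, ← mul_sum, h.sum_eq, sum_const, card_univ,
    h.card_points]
  norm_num
  ring

theorem le_sum_sq (h : IsReducedArc u T) : 336 ≤ ∑ x, u x ^ 2 := by
  have := h.sum_sub_four_sq
  have : 0 ≤ ∑ x, (u x - 4) ^ 2 := sum_nonneg fun x _ => sq_nonneg _
  linarith

/-- Since ∑ (u - 4) = 0, the excess of ∑ u² over 336 is ∑ (u - 4)(u - 3). Each term is a product of
consecutive integers, hence nonnegative, and the term at `x` is 6. -/
theorem le_sum_sq_of_six (h : IsReducedArc u T) {x : X} (hx : u x = 6) :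
    342 ≤ ∑ x, u x ^ 2 := by
  have h1 : ∑ x, (u x - 4) ^ 2 + ∑ x, (u x - 4) = ∑ x, ((u x - 4) ^ 2 + (u x - 4)) :=
    sum_add_distrib.symm
  have h2 : (u x - 4) ^ 2 + (u x - 4) ≤ ∑ x, ((u x - 4) ^ 2 + (u x - 4)) := by
    refine single_le_sum (f := fun x => (u x - 4) ^ 2 + (u x - 4)) (fun y _ => ?_) (mem_univ x)
    obtain h | h := le_or_gt 4 (u y)
    · nlinarith
    · nlinarith
  rw [h.sum_sub_four_sq, sum_sub_distrib, h.sum_eq] at h1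
  simp only [sum_const, card_univ, h.card_points] at h1
  norm_num at h1
  rw [hx] at h2
  linarith

theorem defect_ge (h : IsReducedArc u T) {a : A} {e : Fin 5 → X} (he : Enumerates e (pts X a))
    (h0 : u (e 0) = 4) (h1 : u (e 1) = 4) (h2 : u (e 2) = 4) (h3 : u (e 3) = 3 ∨ u (e 3) = 4) :
    32 ≤ T a := by
  have hu : (fun i => u (e i)) = ![u (e 0), u (e 1), u (e 2), u (e 3), u (e 4)] := by
    ext i; fin_cases i <;> rfl
  have hb := h.defectBound_le a e he
  obtain ⟨n, hn⟩ : ∃ n : Fin 7, u (e 4) = ((n : ℕ) : ℤ) :=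
    ⟨⟨(u (e 4)).toNat, by have := h.le_six (e 4); omega⟩, by
      have := h.nonneg (e 4); simp; omega⟩
  rw [hu, h0, h1, h2, hn] at hb
  obtain h3 | h3 := h3 <;> rw [h3] at hb
  · exact (defectBound_three_fours_three n).trans hb
  · exact (defectBound_four_fours n).trans hb

/-- A multiplicity 5 would cap the line at 21 and a second 6 is excluded, so the other four classes
have multiplicity at most 4 and sum 16. -/
theorem eq_four_of_six (h : IsReducedArc u T) {x : X} (hx : u x = 6) {a : A} (hxa : x ∈ a)
    (ha : lineSum u a = 22) {y : X} (hy : y ∈ a) (hyx : y ≠ x) : u y = 4 := by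
  have hle : ∀ z ∈ a, z ≠ x → u z ≤ 4 := by
    intro z hz hzx
    have h6 := h.le_six z
    by_contra hlt
    obtain h5 | h5 : u z = 5 ∨ u z = 6 := by omega
    · have := h.lineSum_le_of_five z a hz h5
      omega
    · exact h.two_sixes z x a hz hxa hzx h5 hx ha
  obtain ⟨e, he, rfl⟩ := Enumerates.exists_last (card_pts h.order_eq a) (mem_pts.2 hxa)
  have hm := fun i => mem_pts.1 (he.mem i)
  have hs := lineSum_eq (u := u) he
  have l0 := hle _ (hm 0) (he.injective.ne (by decide))
  have l1 := hle _ (hm 1) (he.injective.ne (by decide))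
  have l2 := hle _ (hm 2) (he.injective.ne (by decide))
  have l3 := hle _ (hm 3) (he.injective.ne (by decide))
  obtain ⟨i, rfl⟩ := (he.mem_iff y).1 (mem_pts.2 hy)
  fin_cases i <;> simp only [Fin.isValue, Fin.zero_eta, Fin.mk_one, Fin.reduceFinMk] at * <;>
    first | omega | exact absurd rfl hyx

/-- Splitting the total defect at the lines through a point. -/
theorem sum_defect_ge (h : IsReducedArc u T) {x : X} {f : Fin 5 → A}
    (hf : Enumerates f (lns A x)) (hT : ∀ a : A, x ∉ a → 32 ≤ T a) :
    512 + (T (f 0) + T (f 1) + T (f 2) + T (f 3) + T (f 4)) ≤ ∑ a, T a := by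
  have hs : ∑ a ∈ lns A x, T a = T (f 0) + T (f 1) + T (f 2) + T (f 3) + T (f 4) := by
    rw [hf.sum_eq, Fin.sum_univ_five]
  have hc : #(univ \ lns A x) = 16 := by
    rw [card_sdiff_of_subset (subset_univ _), card_univ, h.card_lines, card_lns h.order_eq]
  have hrest : ∑ a ∈ univ \ lns A x, (32 : ℤ) ≤ ∑ a ∈ univ \ lns A x, T a :=
    sum_le_sum fun a ha => hT a fun hxa => (mem_sdiff.1 ha).2 (mem_lns.2 hxa)
  rw [sum_const, hc, nsmul_eq_mul] at hrest
  rw [← sum_sdiff (subset_univ (lns A x)), hs]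
  push_cast at hrest
  linarith

theorem defect_ge_of_six (h : IsReducedArc u T) {x : X} (hx : u x = 6) {a : A} (hxa : x ∈ a)
    (ha : lineSum u a = 22) : 32 ≤ T a := by
  obtain ⟨e, he, rfl⟩ := Enumerates.exists_last (card_pts h.order_eq a) (mem_pts.2 hxa)
  have h4 : ∀ i, i ≠ 4 → u (e i) = 4 := fun i hi =>
    h.eq_four_of_six hx hxa ha (mem_pts.1 (he.mem i)) (he.injective.ne hi)
  exact h.defect_ge he (h4 0 (by decide)) (h4 1 (by decide)) (h4 2 (by decide))
    (Or.inr (h4 3 (by decide)))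

/-- The case of lines of multiplicities `22, 22, 22, 21, 21`. -/
theorem false_of_six (h : IsReducedArc u T) {x : X} (hx : u x = 6) {f : Fin 5 → A}
    (hf : Enumerates f (lns A x)) (h0 : lineSum u (f 0) = 22) (h1 : lineSum u (f 1) = 22)
    (h2 : lineSum u (f 2) = 22) (h3 : lineSum u (f 3) = 21)
    (hle : ∀ y ∈ f 3, y ≠ x → u y ≤ 4) : False := by
  have hxf : ∀ i, x ∈ f i := fun i => mem_lns.1 (hf.mem i)
  obtain ⟨e, he, hex⟩ := Enumerates.exists_last (card_pts h.order_eq (f 3)) (mem_pts.2 (hxf 3))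
  obtain ⟨e, he, hex, hmono⟩ : ∃ e, Enumerates e (pts X (f 3)) ∧ e 4 = x ∧
      u (e 0) = 4 ∧ u (e 1) = 4 ∧ u (e 2) = 4 ∧ u (e 3) = 3 := by
    have hm := fun i => mem_pts.1 (he.mem i)
    have hs := lineSum_eq (u := u) he
    have hne : ∀ i, i ≠ 4 → e i ≠ x := fun i hi => hex ▸ he.injective.ne hi
    have l0 := hle _ (hm 0) (hne _ (by decide))
    have l1 := hle _ (hm 1) (hne _ (by decide))
    have l2 := hle _ (hm 2) (hne _ (by decide))
    have l3 := hle _ (hm 3) (hne _ (by decide))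
    rw [h3, hex, hx] at hs
    obtain h' | h' | h' | h' : u (e 0) = 3 ∨ u (e 1) = 3 ∨ u (e 2) = 3 ∨ u (e 3) = 3 := by omega
    · refine ⟨_, he.comp (Equiv.swap 0 3), ?_⟩
      have e0 : (Equiv.swap 0 3 : Equiv.Perm (Fin 5)) 0 = 3 := by decide
      have e1 : (Equiv.swap 0 3 : Equiv.Perm (Fin 5)) 1 = 1 := by decide
      have e2 : (Equiv.swap 0 3 : Equiv.Perm (Fin 5)) 2 = 2 := by decide
      have e3 : (Equiv.swap 0 3 : Equiv.Perm (Fin 5)) 3 = 0 := by decide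
      have e4 : (Equiv.swap 0 3 : Equiv.Perm (Fin 5)) 4 = 4 := by decide
      simp only [Function.comp_apply, e0, e1, e2, e3, e4]
      exact ⟨hex, by omega, by omega, by omega, by omega⟩
    · refine ⟨_, he.comp (Equiv.swap 1 3), ?_⟩
      have e0 : (Equiv.swap 1 3 : Equiv.Perm (Fin 5)) 0 = 0 := by decide
      have e1 : (Equiv.swap 1 3 : Equiv.Perm (Fin 5)) 1 = 3 := by decide
      have e2 : (Equiv.swap 1 3 : Equiv.Perm (Fin 5)) 2 = 2 := by decide
      have e3 : (Equiv.swap 1 3 : Equiv.Perm (Fin 5)) 3 = 1 := by decide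
      have e4 : (Equiv.swap 1 3 : Equiv.Perm (Fin 5)) 4 = 4 := by decide
      simp only [Function.comp_apply, e0, e1, e2, e3, e4]
      exact ⟨hex, by omega, by omega, by omega, by omega⟩
    · refine ⟨_, he.comp (Equiv.swap 2 3), ?_⟩
      have e0 : (Equiv.swap 2 3 : Equiv.Perm (Fin 5)) 0 = 0 := by decide
      have e1 : (Equiv.swap 2 3 : Equiv.Perm (Fin 5)) 1 = 1 := by decide
      have e2 : (Equiv.swap 2 3 : Equiv.Perm (Fin 5)) 2 = 3 := by decide
      have e3 : (Equiv.swap 2 3 : Equiv.Perm (Fin 5)) 3 = 2 := by decide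
      have e4 : (Equiv.swap 2 3 : Equiv.Perm (Fin 5)) 4 = 4 := by decide
      simp only [Function.comp_apply, e0, e1, e2, e3, e4]
      exact ⟨hex, by omega, by omega, by omega, by omega⟩
    · exact ⟨e, he, hex, by omega, by omega, by omega, by omega⟩
  have hT3 : 48 ≤ T (f 3) := by
    have hb := h.defectBound_le _ e he
    have hu : (fun i => u (e i)) = ![4, 4, 4, 3, 6] := by
      ext i; fin_cases i <;> simp [hmono, hex, hx]
    rw [hu] at hb
    exact defectBound_three_fours_three_six.trans hb
  -- A line off `x` meets the three lines of multiplicity 22 in classes of multiplicity 4, and `f 3`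
  -- in one of multiplicity 3 or 4.
  have hoff : ∀ a : A, x ∉ a → 32 ≤ T a := by
    intro a hxa
    obtain ⟨p, hp, hpf⟩ := exists_perspectivity h.order_eq hf hxa
    have hpx : ∀ i, p i ≠ x := fun i hi => hxa (hi ▸ mem_pts.1 (hp.mem i))
    refine h.defect_ge hp (h.eq_four_of_six hx (hxf 0) h0 (hpf 0) (hpx 0))
      (h.eq_four_of_six hx (hxf 1) h1 (hpf 1) (hpx 1))
      (h.eq_four_of_six hx (hxf 2) h2 (hpf 2) (hpx 2)) ?_
    obtain ⟨i, hi⟩ := (he.mem_iff (p 3)).1 (mem_pts.2 (hpf 3))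
    have hi4 : i ≠ 4 := fun h4 => hpx 3 (by rw [← hi, h4, hex])
    rw [← hi]
    fin_cases i <;> simp [hmono] at hi4 ⊢
  -- The defects add up to at least 512 + 3 · 32 + 48 = 656, but 1680 - 3 · 342 = 654.
  have hsum := h.sum_defect_ge hf hoff
  have t0 := h.defect_ge_of_six hx (hxf 0) h0
  have t1 := h.defect_ge_of_six hx (hxf 1) h1
  have t2 := h.defect_ge_of_six hx (hxf 2) h2
  have t4 := h.defect_nonneg (f 4)
  have := h.le_sum_sq_of_six hx
  have := h.sum_defect
  linarith

/-- The lines through a class of multiplicity 6 have total 84 + 24 = 108 and at most 22 each, so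
they are 22, 22, 22, 22, 20 or 22, 22, 22, 21, 21. Both make the total defect exceed 654. -/
theorem ne_six (h : IsReducedArc u T) (x : X) : u x ≠ 6 := by
  intro hx
  obtain ⟨f, hf, hanti⟩ := Enumerates.exists_sorted (card_lns h.order_eq x) (lineSum u)
  have hxf : ∀ i, x ∈ f i := fun i => mem_lns.1 (hf.mem i)
  have hs := h.sum_lineSum x
  rw [hf.sum_eq, Fin.sum_univ_five, hx] at hs
  have a01 : lineSum u (f 1) ≤ lineSum u (f 0) := hanti (show (0 : Fin 5) ≤ 1 by decide)
  have a12 : lineSum u (f 2) ≤ lineSum u (f 1) := hanti (show (1 : Fin 5) ≤ 2 by decide)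
  have a23 : lineSum u (f 3) ≤ lineSum u (f 2) := hanti (show (2 : Fin 5) ≤ 3 by decide)
  have a34 : lineSum u (f 4) ≤ lineSum u (f 3) := hanti (show (3 : Fin 5) ≤ 4 by decide)
  have l0 := h.lineSum_le_of_six x _ (hxf 0) hx
  have h0 : lineSum u (f 0) = 22 := by omega
  have h1 : lineSum u (f 1) = 22 := by omega
  have h2 : lineSum u (f 2) = 22 := by omega
  obtain ⟨h3, h4⟩ | ⟨h3, h4⟩ : lineSum u (f 3) = 22 ∧ lineSum u (f 4) = 20 ∨
      lineSum u (f 3) = 21 ∧ lineSum u (f 4) = 21 := by omega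
  · have hoff : ∀ a : A, x ∉ a → 32 ≤ T a := by
      intro a hxa
      obtain ⟨p, hp, hpf⟩ := exists_perspectivity h.order_eq hf hxa
      have hpx : ∀ i, p i ≠ x := fun i hi => hxa (hi ▸ mem_pts.1 (hp.mem i))
      exact h.defect_ge hp (h.eq_four_of_six hx (hxf 0) h0 (hpf 0) (hpx 0))
        (h.eq_four_of_six hx (hxf 1) h1 (hpf 1) (hpx 1))
        (h.eq_four_of_six hx (hxf 2) h2 (hpf 2) (hpx 2))
        (Or.inr (h.eq_four_of_six hx (hxf 3) h3 (hpf 3) (hpx 3)))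
    -- Here the defects add up to at least 512 + 4 · 32 + 15 = 655 > 654.
    have hsum := h.sum_defect_ge hf hoff
    have t0 := h.defect_ge_of_six hx (hxf 0) h0
    have t1 := h.defect_ge_of_six hx (hxf 1) h1
    have t2 := h.defect_ge_of_six hx (hxf 2) h2
    have t3 := h.defect_ge_of_six hx (hxf 3) h3
    have t4 : 15 ≤ T (f 4) := by
      obtain ⟨e, he, hex⟩ :=
        Enumerates.exists_last (card_pts h.order_eq (f 4)) (mem_pts.2 (hxf 4))
      have hb := h.defectBound_le _ _ (he.comp (Equiv.swap 0 4))
      have hS := lineSum_eq (u := u) he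
      rw [h4, hex, hx] at hS
      have hn : ∀ i, ∃ n : Fin 7, u (e i) = ((n : ℕ) : ℤ) := fun i =>
        ⟨⟨(u (e i)).toNat, by have := h.le_six (e i); omega⟩, by
          have := h.nonneg (e i); simp; omega⟩
      obtain ⟨n0, hn0⟩ := hn 0
      obtain ⟨n1, hn1⟩ := hn 1
      obtain ⟨n2, hn2⟩ := hn 2
      obtain ⟨n3, hn3⟩ := hn 3
      have hu : (fun i => u ((e ∘ Equiv.swap (0 : Fin 5) 4) i))
          = ![6, ((n1 : ℕ) : ℤ), ((n2 : ℕ) : ℤ), ((n3 : ℕ) : ℤ), ((n0 : ℕ) : ℤ)] := by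
        ext i
        fin_cases i
        · simp [hex, hx]
        · exact hn1
        · exact hn2
        · exact hn3
        · simp [hn0]
      rw [hu] at hb
      exact (defectBound_six n1 n2 n3 n0 (by omega)).trans hb
    have := h.le_sum_sq_of_six hx
    have := h.sum_defect
    linarith
  · by_cases hle : ∀ y ∈ f 3, y ≠ x → u y ≤ 4
    · exact h.false_of_six hx hf h0 h1 h2 h3 hle
    · push Not at hle
      obtain ⟨z, hz, hzx, hz4⟩ := hle
      -- If `f 3` carries a further class `z` of multiplicity at least 5, then `f 4` carries none:
      -- the line joining two such classes would have multiplicity 12 + u z + u y, violating the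
      -- bound 21 or 22 attached to `z`.
      refine h.false_of_six hx (hf.comp (Equiv.swap 3 4)) h0 h1 h2 (by simpa using h4) ?_
      intro y hy hyx
      replace hy : y ∈ f 4 := by simpa using hy
      have hf34 : f 3 ≠ f 4 := hf.injective.ne (by decide)
      have hzy : z ≠ y := by
        rintro rfl
        exact (Nondegenerate.eq_or_eq hz (hxf 3) hy (hxf 4)).elim hzx hf34
      obtain ⟨a, ⟨hza, hya⟩, -⟩ := HasLines.existsUnique_line X A z y hzy
      have hxa : x ∉ a := by
        intro hxa
        have e3 := (Nondegenerate.eq_or_eq hz (hxf 3) hza hxa).resolve_left hzx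
        have e4 := (Nondegenerate.eq_or_eq hy (hxf 4) hya hxa).resolve_left hyx
        exact hf34 (e3.trans e4.symm)
      obtain ⟨p, hp, hpf⟩ := exists_perspectivity h.order_eq hf hxa
      have hpx : ∀ i, p i ≠ x := fun i hi => hxa (hi ▸ mem_pts.1 (hp.mem i))
      have hpa := fun i => mem_pts.1 (hp.mem i)
      have p3 : p 3 = z := (Nondegenerate.eq_or_eq (hpf 3) hz (hpa 3) hza).resolve_right
        fun h => hxa (h ▸ hxf 3)
      have p4 : p 4 = y := (Nondegenerate.eq_or_eq (hpf 4) hy (hpa 4) hya).resolve_right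
        fun h => hxa (h ▸ hxf 4)
      have hS := lineSum_eq (u := u) hp
      rw [p3, p4, h.eq_four_of_six hx (hxf 0) h0 (hpf 0) (hpx 0),
        h.eq_four_of_six hx (hxf 1) h1 (hpf 1) (hpx 1),
        h.eq_four_of_six hx (hxf 2) h2 (hpf 2) (hpx 2)] at hS
      have := h.le_six z
      obtain h5 | h6 : u z = 5 ∨ u z = 6 := by omega
      · have := h.lineSum_le_of_five z a hza h5
        omega
      · have := h.lineSum_le_of_six z a hza h6
        omega

theorem le_five (h : IsReducedArc u T) (x : X) : u x ≤ 5 := by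
  have := h.le_six x
  have := h.ne_six x
  omega

/-- The lines through a point class of multiplicity `5`. -/
theorem exists_lines_of_five (h : IsReducedArc u T) {x : X} (hx : u x = 5) :
    ∃ f, Enumerates f (lns A x) ∧ lineSum u (f 0) = 21 ∧ lineSum u (f 1) = 21 ∧
      lineSum u (f 2) = 21 ∧ lineSum u (f 3) = 21 ∧ lineSum u (f 4) = 20 := by
  obtain ⟨f, hf, hanti⟩ := Enumerates.exists_sorted (card_lns h.order_eq x) (lineSum u)
  have hs := h.sum_lineSum x
  rw [hf.sum_eq, Fin.sum_univ_five, hx] at hs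
  have a01 : lineSum u (f 1) ≤ lineSum u (f 0) := hanti (show (0 : Fin 5) ≤ 1 by decide)
  have a12 : lineSum u (f 2) ≤ lineSum u (f 1) := hanti (show (1 : Fin 5) ≤ 2 by decide)
  have a23 : lineSum u (f 3) ≤ lineSum u (f 2) := hanti (show (2 : Fin 5) ≤ 3 by decide)
  have a34 : lineSum u (f 4) ≤ lineSum u (f 3) := hanti (show (3 : Fin 5) ≤ 4 by decide)
  have l0 := h.lineSum_le_of_five x _ (mem_lns.1 (hf.mem 0)) hx
  exact ⟨f, hf, by omega, by omega, by omega, by omega, by omega⟩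

/-- A line of multiplicity `21` through point classes of multiplicities `5` and `4`. -/
theorem eq_four_of_five (h : IsReducedArc u T) {a : A} (ha : lineSum u a = 21) {x z : X}
    (hxa : x ∈ a) (hx : u x = 5) (hza : z ∈ a) (hz : u z = 4) {y : X} (hy : y ∈ a)
    (hyx : y ≠ x) : u y = 4 := by
  have hle : ∀ y ∈ a, y ≠ x → u y ≤ 4 := by
    intro y hy hyx
    have h5 := h.le_five y
    by_contra hlt
    exact h.two_fives_four x y z a hxa hy hza hyx.symm hx (by omega) hz ha
  obtain ⟨e, he, rfl⟩ := Enumerates.exists_last (card_pts h.order_eq a) (mem_pts.2 hxa)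
  have hm := fun i => mem_pts.1 (he.mem i)
  have hs := lineSum_eq (u := u) he
  have l0 := hle _ (hm 0) (he.injective.ne (by decide))
  have l1 := hle _ (hm 1) (he.injective.ne (by decide))
  have l2 := hle _ (hm 2) (he.injective.ne (by decide))
  have l3 := hle _ (hm 3) (he.injective.ne (by decide))
  obtain ⟨i, rfl⟩ := (he.mem_iff y).1 (mem_pts.2 hy)
  fin_cases i <;> simp only [Fin.isValue, Fin.zero_eta, Fin.mk_one, Fin.reduceFinMk] at * <;>
    first | omega | exact absurd rfl hyx

/-- A line of multiplicity `21` through no point class of multiplicity `4`. -/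
theorem exists_of_no_four (h : IsReducedArc u T) {a : A} (ha : lineSum u a = 21) (h4 : ∀ z ∈ a, u z ≠ 4) :
    ∃ e, Enumerates e (pts X a) ∧ u (e 0) = 5 ∧ u (e 1) = 5 ∧ u (e 2) = 5 ∧ u (e 3) = 3 ∧
      u (e 4) = 3 := by
  obtain ⟨e, he, hanti⟩ := Enumerates.exists_sorted (card_pts h.order_eq a) u
  have a01 : u (e 1) ≤ u (e 0) := hanti (show (0 : Fin 5) ≤ 1 by decide)
  have a12 : u (e 2) ≤ u (e 1) := hanti (show (1 : Fin 5) ≤ 2 by decide)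
  have a23 : u (e 3) ≤ u (e 2) := hanti (show (2 : Fin 5) ≤ 3 by decide)
  have a34 : u (e 4) ≤ u (e 3) := hanti (show (3 : Fin 5) ≤ 4 by decide)
  have hs := lineSum_eq (u := u) he
  have l0 := h.le_five (e 0)
  have hn := fun i => h4 _ (mem_pts.1 (he.mem i))
  have n0 := hn 0
  have n1 := hn 1
  have n2 := hn 2
  have n3 := hn 3
  have n4 := hn 4
  have h33 : u (e 3) ≠ 5 := by
    intro h3
    refine (h.four_fives a e he fun i hi => ?_).2 ha
    fin_cases i <;> simp only [Fin.isValue, Fin.zero_eta, Fin.mk_one, Fin.reduceFinMk] at * <;>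
      omega
  exact ⟨e, he, by omega, by omega, by omega, by omega, by omega⟩

theorem eq_three_or_five (h : IsReducedArc u T) {a : A} (ha : lineSum u a = 21) (h4 : ∀ z ∈ a, u z ≠ 4) {y : X} (hy : y ∈ a) :
    u y = 3 ∨ u y = 5 := by
  obtain ⟨e, he, h0, h1, h2, h3, h4⟩ := h.exists_of_no_four ha h4
  obtain ⟨i, rfl⟩ := (he.mem_iff y).1 (mem_pts.2 hy)
  fin_cases i <;> simp [*]

theorem card_fives (h : IsReducedArc u T) {a : A} (ha : lineSum u a = 21) (h4 : ∀ z ∈ a, u z ≠ 4) :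
    ∑ y ∈ pts X a, (if u y = 5 then 1 else 0 : ℤ) = 3 := by
  obtain ⟨e, he, h0, h1, h2, h3, h4⟩ := h.exists_of_no_four ha h4
  rw [he.sum_eq, Fin.sum_univ_five]
  simp [*]

/-- Not all lines of multiplicity `21` through the point classes of multiplicity `5` are free
of point classes of multiplicity `4`. -/
theorem exists_four (h : IsReducedArc u T) {x : X} (hx : u x = 5) :
    ∃ (y : X) (a : A) (z : X), y ∈ a ∧ u y = 5 ∧ lineSum u a = 21 ∧ z ∈ a ∧ u z = 4 := by
  by_contra! hno
  have hno' : ∀ (y : X) (a : A), y ∈ a → u y = 5 → lineSum u a = 21 → ∀ z ∈ a, u z ≠ 4 :=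
    fun y a h1 h2 h3 z hz => hno y a z h1 h2 h3 hz
  set c : X → ℤ := fun y => if u y = 5 then 1 else 0 with hc
  set N : ℤ := ∑ y, c y with hN
  -- Under the assumption each line of multiplicity 21 through `y` has three fives; the fifth line
  -- then carries N + 4 - 12 of them.
  have hlast : ∀ y, u y = 5 → ∀ f, Enumerates f (lns A y) → lineSum u (f 0) = 21 →
      lineSum u (f 1) = 21 → lineSum u (f 2) = 21 → lineSum u (f 3) = 21 →
      ∑ z ∈ pts X (f 4), c z = N - 8 := by
    intro y hy f hf h0 h1 h2 h3
    have hyf : ∀ i, y ∈ f i := fun i => mem_lns.1 (hf.mem i)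
    have h' := sum_lns_sum_pts h.order_eq c y (A := A)
    rw [hf.sum_eq, Fin.sum_univ_five, h.card_fives h0 (hno' _ _ (hyf 0) hy h0),
      h.card_fives h1 (hno' _ _ (hyf 1) hy h1),
      h.card_fives h2 (hno' _ _ (hyf 2) hy h2),
      h.card_fives h3 (hno' _ _ (hyf 3) hy h3)] at h'
    have : c y = 1 := by simp [hc, hy]
    linarith
  -- Count flags of a five on a line of multiplicity 21: every five is on four such lines, every
  -- such line has three fives or none.
  have hdiv : (3 : ℤ) ∣ 4 * N := by
    have h1 : ∑ a : A, ∑ y ∈ pts X a, (if lineSum u a = 21 then c y else 0)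
        = ∑ y, 4 * c y := by
      rw [sum_sum_pts]
      refine sum_congr rfl fun y _ => ?_
      by_cases hy : u y = 5
      · obtain ⟨f, hf, h0, h1, h2, h3, h4⟩ := h.exists_lines_of_five hy
        rw [hf.sum_eq, Fin.sum_univ_five]
        simp [h0, h1, h2, h3, h4]
        ring
      · simp [hc, hy]
    rw [hN, mul_sum, ← h1]
    refine dvd_sum fun a _ => ?_
    by_cases ha : lineSum u a = 21
    · simp only [ha, if_true]
      by_cases hex : ∃ y ∈ a, u y = 5
      · obtain ⟨y, hya, hy⟩ := hex
        rw [h.card_fives ha (hno' _ _ hya hy ha)]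
      · push Not at hex
        rw [sum_eq_zero fun y hy => by simp [hc, hex y (mem_pts.1 hy)]]
        exact dvd_zero 3
    · simp [ha]
  -- The line of multiplicity 20 through `x` has between one and three fives, so N is 9, 10 or 11,
  -- and divisibility by 3 leaves 9.
  have hN9 : N = 9 := by
    obtain ⟨f, hf, h0, h1, h2, h3, h4⟩ := h.exists_lines_of_five hx
    have hs := hlast x hx f hf h0 h1 h2 h3
    obtain ⟨e, he, hanti⟩ := Enumerates.exists_sorted (card_pts h.order_eq (f 4)) u
    have a01 : u (e 1) ≤ u (e 0) := hanti (show (0 : Fin 5) ≤ 1 by decide)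
    have a12 : u (e 2) ≤ u (e 1) := hanti (show (1 : Fin 5) ≤ 2 by decide)
    have a23 : u (e 3) ≤ u (e 2) := hanti (show (2 : Fin 5) ≤ 3 by decide)
    have a34 : u (e 4) ≤ u (e 3) := hanti (show (3 : Fin 5) ≤ 4 by decide)
    have hS := lineSum_eq (u := u) he
    have l0 := h.le_five (e 0)
    have hx5 : u (e 0) = 5 := by
      obtain ⟨i, hi⟩ := (he.mem_iff x).1 (mem_pts.2 (mem_lns.1 (hf.mem 4)))
      have : u (e i) ≤ u (e 0) := hanti (show (0 : Fin 5) ≤ i by omega)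
      rw [hi, hx] at this
      omega
    have h33 : u (e 3) ≠ 5 := by
      intro h3
      refine (h.four_fives _ e he fun i hi => ?_).1 h4
      fin_cases i <;> simp only [Fin.isValue, Fin.zero_eta, Fin.mk_one, Fin.reduceFinMk] at * <;>
        omega
    have h43 : u (e 4) ≠ 5 := by omega
    rw [he.sum_eq, Fin.sum_univ_five] at hs
    simp only [hc, hx5, h33, h43, if_true, if_false] at hs
    split_ifs at hs <;> omega
  obtain ⟨f, hf, h0, h1, h2, h3, h4⟩ := h.exists_lines_of_five hx
  have hxf : ∀ i, x ∈ f i := fun i => mem_lns.1 (hf.mem i)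
  obtain ⟨z, hzx, hzf, hz⟩ : ∃ z, z ≠ x ∧ z ∈ f 0 ∧ u z = 5 := by
    obtain ⟨e, he, e0, e1, -⟩ := h.exists_of_no_four h0 (hno' _ _ (hxf 0) hx h0)
    by_cases hex : e 0 = x
    · exact ⟨e 1, fun h1 => absurd (he.injective (hex.trans h1.symm)) (by decide),
        mem_pts.1 (he.mem 1), e1⟩
    · exact ⟨e 0, hex, mem_pts.1 (he.mem 0), e0⟩
  obtain ⟨g, hg, g0, g1, g2, g3, g4⟩ := h.exists_lines_of_five hz
  have hzg : ∀ i, z ∈ g i := fun i => mem_lns.1 (hg.mem i)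
  have hcg := hlast z hz g hg g0 g1 g2 g3
  have hxg : x ∉ g 4 := by
    intro hxg
    have := (Nondegenerate.eq_or_eq hzf (hxf 0) (hzg 4) hxg).resolve_left hzx
    rw [← this, h0] at g4
    omega
  -- As N - 8 = 1, `z` is the only five on `g 4`. This line meets `f 1`, `f 2`, `f 3` in classes of
  -- multiplicity 3, so its last class would need 20 - 5 - 9 = 6.
  obtain ⟨p, hp, hpf⟩ := exists_perspectivity h.order_eq hf hxg
  have hpg := fun i => mem_pts.1 (hp.mem i)
  have p0 : p 0 = z := (Nondegenerate.eq_or_eq (hpf 0) hzf (hpg 0) (hzg 4)).resolve_right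
    fun h => hxg (h ▸ hxf 0)
  have hS := lineSum_eq (u := u) hp
  have c1 := h.eq_three_or_five h1 (hno' _ _ (hxf 1) hx h1) (hpf 1)
  have c2 := h.eq_three_or_five h2 (hno' _ _ (hxf 2) hx h2) (hpf 2)
  have c3 := h.eq_three_or_five h3 (hno' _ _ (hxf 3) hx h3) (hpf 3)
  have l4 := h.le_five (p 4)
  rw [p0, hz, g4] at hS
  rw [hp.sum_eq, Fin.sum_univ_five, hN9, p0] at hcg
  simp only [hc, hz, if_true] at hcg
  split_ifs at hcg <;> omega

/-- A line of multiplicity `21` through a point class of multiplicity `4`. -/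
def IsTight (u : X → ℤ) (a : A) : Prop := lineSum u a = 21 ∧ ∃ z ∈ a, u z = 4

theorem IsTight.eq_four (h : IsReducedArc u T) {a : A} (ha : IsTight u a) {x y : X}
    (hxa : x ∈ a) (hx : u x = 5) (hy : y ∈ a) (hyx : y ≠ x) : u y = 4 := by
  obtain ⟨ha, z, hza, hz⟩ := ha
  exact h.eq_four_of_five ha hxa hx hza hz hy hyx

theorem IsTight.le_defect (h : IsReducedArc u T) {a : A} (ha : IsTight u a) {x : X}
    (hxa : x ∈ a) (hx : u x = 5) : 52 ≤ T a := by
  obtain ⟨e, he, rfl⟩ := Enumerates.exists_last (card_pts h.order_eq a) (mem_pts.2 hxa)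
  have hb := h.defectBound_le _ e he
  have h4 : ∀ i, i ≠ 4 → u (e i) = 4 := fun i hi =>
    ha.eq_four h hxa hx (mem_pts.1 (he.mem i)) (he.injective.ne hi)
  have hu : (fun i => u (e i)) = ![4, 4, 4, 4, 5] := by
    ext i
    fin_cases i
    · exact h4 0 (by decide)
    · exact h4 1 (by decide)
    · exact h4 2 (by decide)
    · exact h4 3 (by decide)
    · exact hx
  rw [hu] at hb
  exact defectBound_four_fours_five.trans hb

/-- At least three lines through `x` are tight. -/
def ThreeTight (u : X → ℤ) (f : Fin 5 → A) : Prop :=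
  IsTight u (f 0) ∧ IsTight u (f 1) ∧ IsTight u (f 2) ∧ lineSum u (f 3) = 21 ∧
    lineSum u (f 4) = 20

theorem exists_threeTight_aux {x : X} (i₀ : Fin 5)
    {f : Fin 5 → A} (hf : Enumerates f (lns A x)) (hf4 : lineSum u (f 4) = 20)
    (hft : ∀ i, i ≠ 4 → lineSum u (f i) = 21 ∧ (i ≠ i₀ → IsTight u (f i))) :
    ∃ f, Enumerates f (lns A x) ∧ ThreeTight u f := by
  by_cases h3 : i₀ = 4
  · exact ⟨f, hf, (hft 0 (by decide)).2 (by rw [h3]; decide),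
      (hft 1 (by decide)).2 (by rw [h3]; decide), (hft 2 (by decide)).2 (by rw [h3]; decide),
      (hft 3 (by decide)).1, hf4⟩
  · have key : ∀ i₀ i : Fin 5, i₀ ≠ 4 → i ≠ 3 → i ≠ 4 →
        Equiv.swap i₀ 3 i ≠ 4 ∧ Equiv.swap i₀ 3 i ≠ i₀ := by decide
    have key4 : ∀ i₀ : Fin 5, i₀ ≠ 4 → Equiv.swap i₀ 3 4 = 4 := by decide
    have hk : ∀ i, i ≠ 3 → i ≠ 4 → IsTight u (f (Equiv.swap i₀ 3 i)) := fun i hi hi4 =>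
      (hft _ (key i₀ i h3 hi hi4).1).2 (key i₀ i h3 hi hi4).2
    refine ⟨_, hf.comp (Equiv.swap i₀ 3), hk 0 (by decide) (by decide),
      hk 1 (by decide) (by decide), hk 2 (by decide) (by decide), ?_, ?_⟩
    · simpa using (hft i₀ h3).1
    · simpa [key4 i₀ h3] using hf4

/-- A tight line not through `x` forces three tight lines through `x`. -/
theorem exists_threeTight_of_notMem (h : IsReducedArc u T) {x z : X} (hx : u x = 5) {a : A}
    (ha : IsTight u a) (hza : z ∈ a) (hz : u z = 5) (hxa : x ∉ a) :
    ∃ f, Enumerates f (lns A x) ∧ ThreeTight u f := by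
  obtain ⟨f, hf, h0, h1, h2, h3, h4⟩ := h.exists_lines_of_five hx
  have h21 : ∀ i, i ≠ 4 → lineSum u (f i) = 21 := by
    intro i hi
    fin_cases i <;> simp_all
  -- All classes on `a` except `z` have multiplicity 4, so each line of multiplicity 21 through `x`
  -- that misses `z` is tight.
  obtain ⟨p, hp, hpf⟩ := exists_perspectivity h.order_eq hf hxa
  obtain ⟨i₀, hi₀⟩ := (hp.mem_iff z).1 (mem_pts.2 hza)
  refine exists_threeTight_aux i₀ hf h4 fun i hi => ⟨h21 i hi, fun hii => ⟨h21 i hi, p i,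
    hpf i, ha.eq_four h hza hz (mem_pts.1 (hp.mem i)) ?_⟩⟩
  rw [← hi₀]
  exact hp.injective.ne hii

/-- It suffices to find a tight line through a five but not through `x`. If the given one contains
`x`, another five `w` lies off it and has two tight lines, at most one of them through `x`. If there
is no other five, no line through `x` can carry three fives, so all its lines of multiplicity 21 are
tight. -/
theorem exists_threeTight (h : IsReducedArc u T) {x : X} (hx : u x = 5) :
    ∃ f, Enumerates f (lns A x) ∧ ThreeTight u f := by
  obtain ⟨z, a, y, hza, hz, ha, hya, hy⟩ := h.exists_four hx
  have hat : IsTight u a := ⟨ha, y, hya, hy⟩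
  by_cases hxa : x ∈ a
  · by_cases hex : ∃ w, w ≠ x ∧ u w = 5
    · obtain ⟨w, hwx, hw⟩ := hex
      have hwa : w ∉ a := fun hwa => by
        have := hat.eq_four h hxa hx hwa hwx
        omega
      obtain ⟨g, hg, g0, g1, -⟩ := h.exists_threeTight_of_notMem hw hat hza hz hwa
      have hwg : ∀ i, w ∈ g i := fun i => mem_lns.1 (hg.mem i)
      by_cases hx0 : x ∈ g 0
      · refine h.exists_threeTight_of_notMem hx g1 (hwg 1) hw fun hx1 => ?_
        have := (Nondegenerate.eq_or_eq (hwg 0) hx0 (hwg 1) hx1).resolve_left hwx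
        exact absurd (hg.injective this) (by decide)
      · exact h.exists_threeTight_of_notMem hx g0 (hwg 0) hw hx0
    · push Not at hex
      obtain ⟨f, hf, h0, h1, h2, h3, h4⟩ := h.exists_lines_of_five hx
      have hxf : ∀ i, x ∈ f i := fun i => mem_lns.1 (hf.mem i)
      have ht : ∀ i, lineSum u (f i) = 21 → IsTight u (f i) := by
        intro i hi
        refine ⟨hi, ?_⟩
        by_contra hno
        push Not at hno
        have hc := h.card_fives hi hno
        have : ∀ y ∈ pts X (f i), (if u y = 5 then (1 : ℤ) else 0) ≤ if y = x then 1 else 0 := by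
          intro y _
          by_cases hyx : y = x
          · simp [hyx, hx]
          · simp [hyx, hex y hyx]
        have := sum_le_sum this
        rw [hc] at this
        simp [hxf i] at this
      exact ⟨f, hf, ht 0 h0, ht 1 h1, ht 2 h2, h3, h4⟩
  · exact h.exists_threeTight_of_notMem hx hat hza hz hxa

/-- Discharging: write T ≥ 32 + (number of fives) · g on every line. The weights g on the lines
through any five sum to at least 3 · 20 - 11 - 32 = 17, so ∑ T ≥ 672 + 17, whereas ∑ T ≤ 672. -/
theorem ne_five (h : IsReducedArc u T) (x : X) : u x ≠ 5 := by
  intro hx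
  -- A tight line with a five has one five and T ≥ 52 = 32 + 20. A nontight line of multiplicity 21
  -- with a five has three, and 32 - 3 · 11 < 0. Any other line with a five is covered by 32 - 32 =
  -- 0.
  set g : A → ℤ := fun a => if IsTight u a then 20 else if lineSum u a = 21 then -11 else -32
    with hg
  set c : X → ℤ := fun y => if u y = 5 then 1 else 0 with hc
  have hlow : ∀ a : A, (∀ y ∈ a, u y ≠ 5) → 32 ≤ T a := by
    intro a ha
    have hxa : x ∉ a := fun hxa => ha x hxa hx
    obtain ⟨f, hf, h0, h1, h2, h3, h4⟩ := h.exists_threeTight hx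
    have hxf : ∀ i, x ∈ f i := fun i => mem_lns.1 (hf.mem i)
    obtain ⟨p, hp, hpf⟩ := exists_perspectivity h.order_eq hf hxa
    have hpx : ∀ i, p i ≠ x := fun i hi => hxa (hi ▸ mem_pts.1 (hp.mem i))
    refine h.defect_ge hp (h0.eq_four h (hxf 0) hx (hpf 0) (hpx 0))
      (h1.eq_four h (hxf 1) hx (hpf 1) (hpx 1)) (h2.eq_four h (hxf 2) hx (hpf 2) (hpx 2)) ?_
    by_cases ht : IsTight u (f 3)
    · exact Or.inr (ht.eq_four h (hxf 3) hx (hpf 3) (hpx 3))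
    · have hno : ∀ z ∈ f 3, u z ≠ 4 := fun z hz hz4 => ht ⟨h3, z, hz, hz4⟩
      exact Or.inl ((h.eq_three_or_five h3 hno (hpf 3)).resolve_right
        (ha _ (mem_pts.1 (hp.mem 3))))
  have hline : ∀ a : A, 32 + ∑ y ∈ pts X a, g a * c y ≤ T a := by
    intro a
    rw [← mul_sum]
    by_cases hex : ∃ y ∈ a, u y = 5
    · obtain ⟨y, hya, hy⟩ := hex
      have hpos : 1 ≤ ∑ y ∈ pts X a, c y := by
        have := single_le_sum (f := c) (fun z _ => by simp only [hc]; split_ifs <;> norm_num)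
          (mem_pts.2 hya)
        simpa [hc, hy] using this
      by_cases ht : IsTight u a
      · have hsum : ∑ z ∈ pts X a, c z = 1 := by
          rw [sum_eq_single_of_mem y (mem_pts.2 hya)]
          · simp [hc, hy]
          · intro z hz hzy
            simp [hc, ht.eq_four h hya hy (mem_pts.1 hz) hzy]
        rw [hsum]
        simp only [hg, ht, if_true]
        linarith [ht.le_defect h hya hy]
      · by_cases h21 : lineSum u a = 21
        · have h3 := h.card_fives h21 fun z hz hz4 => ht ⟨h21, z, hz, hz4⟩
          simp only [hc, h3, hg, ht, h21, if_true, if_false]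
          linarith [h.defect_nonneg a]
        · simp only [hg, ht, h21, if_false]
          linarith [h.defect_nonneg a]
    · push Not at hex
      rw [sum_eq_zero fun y hy => by simp [hc, hex y (mem_pts.1 hy)]]
      linarith [hlow a hex]
  have hpoint : ∀ y, 17 * c y ≤ ∑ a ∈ lns A y, g a * c y := by
    intro y
    by_cases hy : u y = 5
    · obtain ⟨f, hf, h0, h1, h2, h3, h4⟩ := h.exists_threeTight hy
      have h4' : ¬IsTight u (f 4) := fun ht => by
        have := ht.1
        omega
      have h3' : -11 ≤ g (f 3) := by
        simp only [hg, h3, if_true]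
        split_ifs <;> norm_num
      rw [hf.sum_eq, Fin.sum_univ_five]
      have e0 : g (f 0) = 20 := by simp [hg, h0]
      have e1 : g (f 1) = 20 := by simp [hg, h1]
      have e2 : g (f 2) = 20 := by simp [hg, h2]
      have e4 : g (f 4) = -32 := by simp [hg, h4, h4']
      have ec : c y = 1 := by simp [hc, hy]
      rw [e0, e1, e2, e4, ec]
      linarith
    · simp [hc, hy]
  have h1 := sum_le_sum fun a (_ : a ∈ univ) => hline a
  rw [sum_add_distrib, sum_sum_pts, sum_const, card_univ, h.card_lines] at h1
  have h2 := sum_le_sum fun y (_ : y ∈ univ) => hpoint y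
  have h3 := single_le_sum (f := fun y => 17 * c y)
    (fun z _ => by simp only [hc]; split_ifs <;> norm_num) (mem_univ x)
  have h4 : c x = 1 := by simp [hc, hx]
  have := h.sum_defect
  have := h.le_sum_sq
  simp only [h4, nsmul_eq_mul] at h1 h3
  push_cast at h1
  linarith

theorem eq_four (h : IsReducedArc u T) (x : X) : u x = 4 := by
  have hle : ∀ y, u y ≤ 4 := fun y => by
    have := h.le_five y
    have := h.ne_five y
    omega
  have h1 : ∑ y, (4 - u y) = 0 := by
    rw [sum_sub_distrib, h.sum_eq]
    simp [h.card_points]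
  have h2 := (sum_eq_zero_iff_of_nonneg fun y _ => by linarith [hle y]).1 h1 x (mem_univ x)
  linarith

theorem defect_eq (h : IsReducedArc u T) (a : A) : T a = 32 := by
  have hle : ∀ b : A, 32 ≤ T b := fun b => by
    obtain ⟨e, he⟩ := Enumerates.exists_of_card (card_pts h.order_eq b)
    exact h.defect_ge he (h.eq_four _) (h.eq_four _) (h.eq_four _) (Or.inr (h.eq_four _))
  have h1 : ∑ b : A, (T b - 32) = 0 := by
    rw [sum_sub_distrib, h.sum_defect]
    simp [h.eq_four, h.card_points, h.card_lines]
  have h2 := (sum_eq_zero_iff_of_nonneg fun y _ => by linarith [hle y]).1 h1 a (mem_univ a)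
  linarith

end IsReducedArc

end ReducedArc

/-! ### Excluded multiplicity patterns in a class of lines. -/

namespace IsLineClass

variable {ι B F : Type*} [Fintype ι] [Fintype B] [Fintype F] [DecidableEq ι] [DecidableEq B]
  [DecidableEq F] {τ : ι → B → F} {w : ι → F → ℤ}

set_option linter.unusedSectionVars false

theorem comp_equiv {κ : Type*} [Fintype κ] (h : IsLineClass τ w) (e : κ ≃ ι) :
    IsLineClass (fun i => τ (e i)) fun i => w (e i) where
  net := h.net.comp_equiv e
  nonneg _ _ := h.nonneg _ _
  mult_le b := (e.sum_comp fun i => w i (τ i b)).trans_le (h.mult_le b)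

theorem defect_comp_equiv {κ : Type*} [Fintype κ] (e : κ ≃ ι) :
    defect (fun i => τ (e i)) (fun i => w (e i)) = defect τ w := by
  have h : ∀ b, IsAffineNet.mult (fun i => τ (e i)) (fun i => w (e i)) b
      = IsAffineNet.mult τ w b := fun b => e.sum_comp fun i => w i (τ i b)
  simp only [defect, h]

theorem exists_two_le_weight (h : IsLineClass τ w) {i : ι} (hi : 5 ≤ classMult w i) :
    ∃ t, 2 ≤ w i t := by
  by_contra! hlt
  have : classMult w i ≤ ∑ _t : F, (1 : ℤ) := sum_le_sum fun t _ => by linarith [hlt t]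
  rw [sum_const, card_univ, h.net.card_labels] at this
  norm_num at this
  linarith

theorem totalMult_le (h : IsLineClass τ w) {i : ι} (hi : 5 ≤ classMult w i) :
    totalMult w ≤ 16 + classMult w i := by
  obtain ⟨t, ht⟩ := h.exists_two_le_weight hi
  have := h.weight_le i t
  linarith

/-- Here ∑ (w - 1)(w - 2) = -6 + 8 = 2, yet every term with w = 1 or w = 2 vanishes. -/
theorem exists_weight_eq_zero (h : IsLineClass τ w) {i : ι} (hw : ∀ t, w i t ≤ 2)
    (hq : ∑ t, w i t ^ 2 - 3 * classMult w i = -6) : ∃ t, w i t = 0 := by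
  by_contra! hne
  have h1 : ∑ t, (w i t ^ 2 - 3 * w i t + 2) = 0 := by
    refine sum_eq_zero fun t _ => ?_
    have h0 := h.nonneg i t
    have h2 := hw t
    have h3 := hne t
    obtain h4 | h4 : w i t = 1 ∨ w i t = 2 := by omega
    all_goals rw [h4]; norm_num
  rw [sum_add_distrib, sum_sub_distrib, ← mul_sum, sum_const, card_univ, h.net.card_labels] at h1
  rw [classMult] at hq
  norm_num at h1
  linarith

theorem le_row (h : IsLineClass τ w) (i : ι) (b : B) :
    6 - IsAffineNet.mult τ w b ≤ 24 + classMult w i - totalMult w - 4 * w i (τ i b) := by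
  rw [← h.sum_row_sub]
  exact single_le_sum (f := fun b => 6 - IsAffineNet.mult τ w b)
    (fun c _ => by linarith [h.mult_le c]) (by simp)

/-- The four lines through a segment of class `i` meet each segment of class `j` exactly once.
Deficiency bounds depending only on the label in class `j` can therefore be summed over all labels.
-/
theorem row_le (h : IsLineClass τ w) {i j : ι} (hij : i ≠ j) (s : F) (g : F → ℤ)
    (hg : ∀ b, 2 * (6 - IsAffineNet.mult τ w b) ≤ g (τ j b)) :
    2 * (24 + classMult w i - totalMult w - 4 * w i s) ≤ ∑ t, g t := by
  rw [← h.sum_row_sub, mul_sum, ← h.net.sum_row hij s g]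
  exact sum_le_sum fun b _ => hg b

theorem totalMult_ne_of_six_six (h : IsLineClass τ w) {i j : ι} (hij : i ≠ j)
    (hi : classMult w i = 6) (hj : classMult w j = 6) (hqi : ∑ t, w i t ^ 2 = 12)
    (hqj : ∑ t, w j t ^ 2 = 12) : totalMult w ≠ 22 := by
  intro hW
  have hw : ∀ k, classMult w k = 6 → ∀ t, w k t ≤ 2 := fun k hk t => by
    have := h.weight_le k t
    rw [hk, hW] at this
    linarith
  obtain ⟨s, hs⟩ := h.exists_weight_eq_zero (hw i hi) (by rw [hqi, hi]; norm_num)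
  have h0 : ∀ t, w j t * (2 - w j t) = 0 := by
    have h1 : ∑ t, w j t * (2 - w j t) = 0 := by
      have : ∀ t, w j t * (2 - w j t) = 2 * w j t - w j t ^ 2 := fun t => by ring
      rw [sum_congr rfl fun t _ => this t, sum_sub_distrib, ← mul_sum, hqj]
      rw [classMult] at hj
      rw [hj]
      norm_num
    intro t
    exact (sum_eq_zero_iff_of_nonneg fun t _ =>
      mul_nonneg (h.nonneg j t) (by linarith [hw j hj t])).1 h1 t (mem_univ t)
  -- The weights in class `j` are 2, 2, 2, 0. Lines through a weight 2 have deficiency 0, so the row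
  -- of the empty segment `s` has total deficiency at most 6, but it must be 8.
  have h1 := h.row_le hij s (fun t => 12 - 6 * w j t) fun b => by
    have h2 := h.le_row j b
    rw [hj, hW] at h2
    obtain h3 | h3 := mul_eq_zero.1 (h0 (τ j b))
    · linarith [h.mult_nonneg b]
    · linarith
  rw [sum_sub_distrib, ← mul_sum, sum_const, card_univ, h.net.card_labels, hi, hW, hs] at h1
  rw [classMult] at hj
  rw [hj] at h1
  norm_num at h1

theorem sum_triangle (i : ι) (c : ℤ) (hi : classMult w i = 5) (hq : ∑ t, w i t ^ 2 = 9) :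
    ∑ t, c * (w i t ^ 2 - w i t) = 4 * c := by
  rw [← mul_sum, sum_sub_distrib, hq]
  rw [classMult] at hi
  rw [hi]
  ring

theorem totalMult_ne_of_five_five_four (h : IsLineClass τ w) {i j k : ι} (hij : i ≠ j)
    (hi : classMult w i = 5) (hj : classMult w j = 5) (hk : classMult w k = 4)
    (hqi : ∑ t, w i t ^ 2 = 9) (hqj : ∑ t, w j t ^ 2 = 9) : totalMult w ≠ 21 := by
  intro hW
  have hw : ∀ l, classMult w l = 5 → ∀ t, w l t ≤ 2 := fun l hl t => by
    have := h.weight_le l t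
    rw [hl, hW] at this
    linarith
  obtain ⟨s, hs⟩ := h.exists_weight_eq_zero (hw i hi) (by rw [hqi, hi]; norm_num)
  have hk1 : ∀ t, w k t = 1 := by
    have hle : ∀ t, w k t ≤ 1 := fun t => by
      have := h.weight_le k t
      rw [hk, hW] at this
      omega
    have h1 : ∑ t, (1 - w k t) = 0 := by
      rw [sum_sub_distrib, sum_const, card_univ, h.net.card_labels]
      rw [classMult] at hk
      rw [hk]
      norm_num
    intro t
    have := (sum_eq_zero_iff_of_nonneg fun t _ => sub_nonneg.2 (hle t)).1 h1 t (mem_univ t)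
    linarith
  -- Class `k` has all weights 1, which limits every deficiency to 3; a weight 2 in class `j` forces
  -- deficiency 0. With two such weights the row of the empty segment totals at most 6 instead of 8.
  have h1 := h.row_le hij s (fun t => 6 - 3 * (w j t ^ 2 - w j t)) fun b => by
    have h2 := h.le_row k b
    have h3 := h.le_row j b
    rw [hk, hW, hk1] at h2
    rw [hj, hW] at h3
    have h4 := h.nonneg j (τ j b)
    have h5 := hw j hj (τ j b)
    generalize w j (τ j b) = v at *
    interval_cases v <;> norm_num <;> linarith
  rw [sum_sub_distrib, sum_triangle j 3 hj hqj, sum_const, card_univ, h.net.card_labels, hi, hW,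
    hs] at h1
  norm_num at h1

theorem sum_eq_of_fives (h : IsLineClass τ w) {k : ι} (f : ι → ℤ) (c : ℤ)
    (hf : ∀ i, i ≠ k → f i = c) : ∑ i, f i = f k + 4 * c := by
  rw [← add_sum_erase _ _ (mem_univ k), sum_congr rfl fun i hi => hf i (ne_of_mem_erase hi),
    sum_const, card_erase_of_mem (mem_univ k), card_univ, h.net.card_index]
  norm_num

theorem defect_eq_of_four_fives (h : IsLineClass τ w) {k : ι}
    (h5 : ∀ i, i ≠ k → classMult w i = 5) (hq : ∀ i, i ≠ k → ∑ t, w i t ^ 2 = 9) :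
    defect τ w = 24 * totalMult w - totalMult w ^ 2 - 44
      + (classMult w k ^ 2 - 4 * ∑ t, w k t ^ 2) := by
  rw [h.defect_eq, h.sum_eq_of_fives (k := k) (fun i => classMult w i ^ 2 - 4 * ∑ t, w i t ^ 2)
    (-11) fun i hi => by rw [h5 i hi, hq i hi]; norm_num]
  ring

theorem totalMult_eq_of_four_fives (h : IsLineClass τ w) {k : ι}
    (h5 : ∀ i, i ≠ k → classMult w i = 5) : totalMult w = classMult w k + 20 := by
  rw [totalMult, h.sum_eq_of_fives (k := k) _ 5 h5]
  norm_num

theorem totalMult_ne_of_four_fives (h : IsLineClass τ w) {k : ι}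
    (h5 : ∀ i, i ≠ k → classMult w i = 5) (hq : ∀ i, i ≠ k → ∑ t, w i t ^ 2 = 9) :
    totalMult w ≠ 20 ∧ totalMult w ≠ 21 := by
  have hT := h.defect_eq_of_four_fives h5 hq
  have hW' := h.totalMult_eq_of_four_fives h5
  constructor <;> intro hW
  · have hk : classMult w k = 0 := by linarith
    have hqk : 0 ≤ ∑ t, w k t ^ 2 := sum_nonneg fun t _ => sq_nonneg _
    rw [hW, hk] at hT
    obtain ⟨h2, -⟩ | ⟨h0, -⟩ | ⟨j, h1, -⟩ := h.defect_cases
    · obtain ⟨i, hi⟩ := h.net.exists_ne k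
      -- For deficiencies d, the sum of d (4 - d) is the defect minus 32, hence at most 4. Each of
      -- the two segments of weight 2 in class `i` has row deficiency 1 and so contributes 3, a
      -- total of at least 6.
      have hrow : ∀ s, 3 * (w i s ^ 2 - w i s) ≤ 2 * ∑ b with τ i b = s,
          (6 - IsAffineNet.mult τ w b) * (4 - (6 - IsAffineNet.mult τ w b)) := by
        intro s
        have hnn : ∀ b, 0 ≤ (6 - IsAffineNet.mult τ w b) * (4 - (6 - IsAffineNet.mult τ w b)) :=
          fun b => mul_nonneg (by linarith [h.mult_le b]) (by linarith [h2 b])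
        have hws := h.weight_le i s
        have hws0 := h.nonneg i s
        rw [h5 i hi, hW] at hws
        obtain h3 | h3 : w i s = 2 ∨ w i s ^ 2 - w i s = 0 := by
          have : w i s ≤ 2 := by omega
          generalize w i s = v at *
          interval_cases v <;> simp
        · have hsum := h.sum_row_sub i s
          rw [h5 i hi, hW, h3] at hsum
          have : 3 * ∑ b with τ i b = s, (6 - IsAffineNet.mult τ w b) ≤ ∑ b with τ i b = s,
              (6 - IsAffineNet.mult τ w b) * (4 - (6 - IsAffineNet.mult τ w b)) := by
            rw [mul_sum]
            refine sum_le_sum fun b hb => ?_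
            have h4 := h.le_row i b
            rw [(mem_filter.1 hb).2, h5 i hi, hW, h3] at h4
            nlinarith [h.mult_le b]
          rw [hsum] at this
          rw [h3]
          linarith
        · rw [h3]
          have := sum_nonneg fun b (_ : b ∈ ({b | τ i b = s} : Finset B)) => hnn b
          linarith
      have h3 := sum_le_sum fun s (_ : s ∈ univ) => hrow s
      rw [sum_triangle i 3 (h5 i hi) (hq i hi), ← mul_sum,
        sum_fiberwise univ (τ i) fun b =>
          (6 - IsAffineNet.mult τ w b) * (4 - (6 - IsAffineNet.mult τ w b))] at h3
      have h4 : ∑ b, (6 - IsAffineNet.mult τ w b) * (4 - (6 - IsAffineNet.mult τ w b))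
          = defect τ w - 2 * ∑ b, (6 - IsAffineNet.mult τ w b) := by
        rw [defect, mul_sum, ← sum_sub_distrib]
        exact sum_congr rfl fun b _ => by ring
      rw [h4, h.sum_sub, hW] at h3
      linarith
    · have := h0 k
      rw [hk, hW] at this
      norm_num at this
    · have := h1 k
      rw [hk, hW] at this
      split_ifs at this <;> norm_num at this
  · have hk : classMult w k = 1 := by linarith
    have hqk : classMult w k ≤ ∑ t, w k t ^ 2 := sum_le_sum fun t _ => by
      have := h.nonneg k t
      nlinarith
    rw [hk] at hqk
    rw [hW, hk] at hT
    obtain ⟨-, h2⟩ | ⟨h0, -⟩ | ⟨j, h1, -⟩ := h.defect_cases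
    · rw [hW] at h2
      linarith
    · have := h0 k
      rw [hk, hW] at this
      norm_num at this
    · have h3 := h1 j
      rw [if_pos rfl, hW] at h3
      by_cases hj : j = k
      · rw [hj, hk] at h3
        norm_num at h3
      · rw [h5 j hj] at h3
        norm_num at h3

/-- If all point classes have multiplicity `4` and the defect is `32`, every line has multiplicity
`2` or `6`. -/
theorem mult_eq_of_fours (h : IsLineClass τ w) (h4 : ∀ i, classMult w i = 4)
    (hT : defect τ w = 32) (b : B) :
    IsAffineNet.mult τ w b = 2 ∨ IsAffineNet.mult τ w b = 6 := by
  have hW : totalMult w = 20 := by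
    rw [totalMult, sum_congr rfl fun i _ => h4 i, sum_const, card_univ, h.net.card_index]
    norm_num
  -- With all multiplicities at least 2, the nonnegative terms d (4 - d) sum to 32 - 2 · 16 = 0. A
  -- line of multiplicity 0 would cost 5 · 8 = 40 > 32, and multiplicity 1 makes a triple's
  -- deficiency -1.
  obtain ⟨h2, -⟩ | ⟨-, h0⟩ | ⟨j, h1, -⟩ := h.defect_cases
  · have h3 : ∑ b, (6 - IsAffineNet.mult τ w b) * (4 - (6 - IsAffineNet.mult τ w b))
        = defect τ w - 2 * ∑ b, (6 - IsAffineNet.mult τ w b) := by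
      rw [defect, mul_sum, ← sum_sub_distrib]
      exact sum_congr rfl fun b _ => by ring
    rw [h.sum_sub, hW, hT] at h3
    norm_num at h3
    have h5 := (sum_eq_zero_iff_of_nonneg fun b _ =>
      mul_nonneg (by linarith [h.mult_le b]) (by linarith [h2 b])).1 h3 b (mem_univ b)
    obtain h6 | h6 := mul_eq_zero.1 h5
    · right; linarith
    · left; linarith
  · simp only [h4, hW, hT, sum_const, card_univ, h.net.card_index] at h0
    norm_num [sixDefect] at h0
  · have h3 := h1 j
    rw [if_pos rfl, hW, h4] at h3
    norm_num at h3

end IsLineClass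

/-! ### Arcs in a coordinatised Hjelmslev plane. -/

open Configuration in
open scoped Classical in
/-- Coordinates for a projective Hjelmslev plane over a projective plane of order `4`: the points
in the neighbour class `x` are the pairs `(x, y)`, the lines in the neighbour class `a` are the
pairs `(a, b)`, and `(x, y)` is on `(a, b)` if `x` is on `a` and `σ a x y = τ a x b`. -/
structure IsNetPlane {X A Y B F : Type*} [Fintype X] [Fintype A] [Fintype Y] [Fintype B]
    [Fintype F] [Membership X A] [ProjectivePlane X A] (σ : A → X → Y → F) (τ : A → X → B → F) :
    Prop where
  order_eq : ProjectivePlane.order X A = 4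
  point_net : ∀ x : X, IsAffineNet fun (a : {a : A // x ∈ a}) y => σ a x y
  line_net : ∀ a : A, IsAffineNet fun (x : {x : X // x ∈ a}) b => τ a x b

namespace IsNetPlane

open Configuration ReducedArc

open scoped Classical

set_option linter.unusedSectionVars false

variable {X A Y B F : Type*} [Fintype X] [Fintype A] [Fintype Y] [Fintype B]
    [Fintype F] [Membership X A] [ProjectivePlane X A] {σ : A → X → Y → F} {τ : A → X → B → F}
    {K : Finset (X × Y)}

/-- The multiplicity of the neighbour class `x` of points. -/
noncomputable def cls (K : Finset (X × Y)) (x : X) : ℤ := #{p ∈ K | p.1 = x}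

/-- The multiplicities of the line segments in the neighbour class `x` in the direction `a`. -/
noncomputable def seg (σ : A → X → Y → F) (K : Finset (X × Y)) (a : A) (x : X) (t : F) : ℤ :=
  #{p ∈ K | p.1 = x ∧ σ a x p.2 = t}

/-- The multiplicity of the line `(a, b)`. -/
noncomputable def lineMult (σ : A → X → Y → F) (τ : A → X → B → F) (K : Finset (X × Y)) (a : A)
    (b : B) : ℤ :=
  #{p ∈ K | p.1 ∈ a ∧ σ a p.1 p.2 = τ a p.1 b}

/-- The defect of the neighbour class `a` of lines. -/
noncomputable def classDefect (σ : A → X → Y → F) (τ : A → X → B → F) (K : Finset (X × Y))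
    (a : A) : ℤ :=
  IsLineClass.defect (fun (x : {x : X // x ∈ a}) b => τ a x b) fun x t => seg σ K a x t

theorem sum_pts (a : A) (f : X → ℤ) : ∑ x : {x : X // x ∈ a}, f x = ∑ x ∈ pts X a, f x :=
  (sum_subtype _ (fun _ => mem_pts) f).symm

theorem sum_lns (x : X) (f : A → ℤ) : ∑ a : {a : A // x ∈ a}, f a = ∑ a ∈ lns A x, f a :=
  (sum_subtype _ (fun _ => mem_lns) f).symm

theorem sum_seg (σ : A → X → Y → F) (K : Finset (X × Y)) (a : A) (x : X) :
    ∑ t, seg σ K a x t = cls K x := by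
  have := card_eq_sum_card_fiberwise (s := {p ∈ K | p.1 = x}) (t := univ)
    (f := fun p => σ a x p.2) fun _ _ => mem_coe.2 (mem_univ _)
  simp only [filter_filter] at this
  simp only [seg, cls]
  exact_mod_cast this.symm

theorem mult_seg (a : A) (b : B) :
    IsAffineNet.mult (fun (x : {x : X // x ∈ a}) b => τ a x b) (fun x t => seg σ K a x t) b
      = lineMult σ τ K a b := by
  rw [IsAffineNet.mult, sum_pts a fun x => seg σ K a x (τ a x b), lineMult]
  rw [card_eq_sum_card_fiberwise (f := Prod.fst) (t := pts X a) fun p hp => by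
    simpa using (mem_filter.1 hp).2.1]
  push_cast
  refine sum_congr rfl fun x hx => ?_
  rw [seg]
  congr 2
  ext p
  simp only [mem_filter]
  constructor
  · rintro ⟨h1, rfl, h2⟩
    exact ⟨⟨h1, mem_pts.1 hx, h2⟩, rfl⟩
  · rintro ⟨⟨h1, -, h2⟩, rfl⟩
    exact ⟨h1, rfl, h2⟩

theorem sum_cls (K : Finset (X × Y)) : ∑ x, cls K x = #K := by
  have := card_eq_sum_card_fiberwise (s := K) (t := univ) (f := Prod.fst)
    fun _ _ => mem_coe.2 (mem_univ _)
  simp only [cls]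
  exact_mod_cast this.symm

theorem card_fiber_snd (K : Finset (X × Y)) (x : X) (f : Y → Prop) :
    #{y | (x, y) ∈ K ∧ f y} = #{p ∈ K | p.1 = x ∧ f p.2} := by
  rw [← card_map ⟨fun y => (x, y), Prod.mk_right_injective x⟩]
  congr 1
  ext ⟨x', y⟩
  simp only [mem_map, mem_filter, mem_univ, true_and, Function.Embedding.coeFn_mk, Prod.mk.injEq]
  constructor
  · rintro ⟨y', ⟨h1, h2⟩, rfl, rfl⟩
    exact ⟨h1, rfl, h2⟩
  · rintro ⟨h1, rfl, h2⟩
    exact ⟨y, ⟨h1, h2⟩, rfl, rfl⟩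

theorem sum_seg_sq (h : IsNetPlane σ τ) (K : Finset (X × Y)) (x : X) :
    ∑ a ∈ lns A x, ∑ t, seg σ K a x t ^ 2 = cls K x ^ 2 + 4 * cls K x := by
  rw [← sum_lns x fun a => ∑ t, seg σ K a x t ^ 2]
  have h1 := (h.point_net x).sum_card_sq ({y | (x, y) ∈ K} : Finset Y)
  have h2 : (#({y | (x, y) ∈ K} : Finset Y) : ℤ) = cls K x := by
    have := card_fiber_snd K x fun _ => True
    simp only [and_true] at this
    rw [cls, this]
  rw [h2] at h1
  rw [← h1]
  refine sum_congr rfl fun a _ => sum_congr rfl fun t _ => ?_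
  rw [seg, filter_filter, card_fiber_snd K x fun y => σ a x y = t]

theorem isLineClass (h : IsNetPlane σ τ) (hK : ∀ a b, lineMult σ τ K a b ≤ 6) (a : A) :
    IsLineClass (fun (x : {x : X // x ∈ a}) b => τ a x b) fun x t => seg σ K a x t where
  net := h.line_net a
  nonneg _ _ := Nat.cast_nonneg _
  mult_le b := (mult_seg a b).trans_le (hK a b)

theorem totalMult_seg (a : A) :
    IsLineClass.totalMult (fun (x : {x : X // x ∈ a}) t => seg σ K a x t)
      = lineSum (cls K) a := by
  simp only [IsLineClass.totalMult, IsLineClass.classMult, sum_seg]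
  exact sum_pts a (cls K)

theorem classDefect_eq (h : IsNetPlane σ τ) (hK : ∀ a b, lineMult σ τ K a b ≤ 6) (a : A) :
    classDefect σ τ K a = 24 * lineSum (cls K) a - lineSum (cls K) a ^ 2
      + ∑ x ∈ pts X a, (cls K x ^ 2 - 4 * ∑ t, seg σ K a x t ^ 2) := by
  rw [classDefect, (h.isLineClass hK a).defect_eq, totalMult_seg]
  simp only [IsLineClass.classMult, sum_seg]
  rw [sum_pts a fun x => cls K x ^ 2 - 4 * ∑ t, seg σ K a x t ^ 2]

theorem seg_le (h : IsNetPlane σ τ) (hK : ∀ a b, lineMult σ τ K a b ≤ 6) {a : A} {x : X}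
    (hx : x ∈ a) (t : F) : 4 * seg σ K a x t ≤ 24 + cls K x - lineSum (cls K) a := by
  have := (h.isLineClass hK a).weight_le ⟨x, hx⟩ t
  rwa [IsLineClass.classMult, sum_seg, totalMult_seg] at this

theorem seg_nonneg (a : A) (x : X) (t : F) : 0 ≤ seg σ K a x t := Nat.cast_nonneg _

theorem cls_nonneg (x : X) : 0 ≤ cls K x := Nat.cast_nonneg _

theorem sum_lineSum_cls (h : IsNetPlane σ τ) (hc : #K = 84) (x : X) :
    ∑ a ∈ lns A x, lineSum (cls K) a = 84 + 4 * cls K x := by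
  simp only [lineSum]
  rw [sum_lns_sum_pts h.order_eq, sum_cls, hc]
  norm_num

/-- Multiply the bound on each segment by its multiplicity and sum over all directions: 4 (u² + 4u)
≤ u (36 + u), that is 3u² ≤ 20u. -/
theorem cls_le_six (h : IsNetPlane σ τ) (hK : ∀ a b, lineMult σ τ K a b ≤ 6) (hc : #K = 84)
    (x : X) : cls K x ≤ 6 := by
  have h1 : ∀ a ∈ lns A x, 4 * ∑ t, seg σ K a x t ^ 2
      ≤ cls K x * (24 + cls K x - lineSum (cls K) a) := by
    intro a ha
    rw [← sum_seg σ K a x, mul_sum, sum_mul, sum_seg σ K a x]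
    refine sum_le_sum fun t _ => ?_
    have := mul_le_mul_of_nonneg_left (h.seg_le hK (mem_lns.1 ha) t) (seg_nonneg (σ := σ) (K := K) a x t)
    linarith
  have h2 := sum_le_sum h1
  rw [← mul_sum, h.sum_seg_sq, ← mul_sum, sum_sub_distrib, h.sum_lineSum_cls hc, sum_const,
    card_lns h.order_eq] at h2
  have h3 := cls_nonneg (K := K) x
  by_contra! h4
  norm_num at h2
  nlinarith

/-- Sum `classDefect_eq` over all lines of PG(2,4). The segment squares enter only through their sum
over the directions at each point, which `sum_seg_sq` expresses by u alone. -/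
theorem sum_classDefect (h : IsNetPlane σ τ) (hK : ∀ a b, lineMult σ τ K a b ≤ 6) (hc : #K = 84) :
    ∑ a, classDefect σ τ K a = 1680 - 3 * ∑ x, cls K x ^ 2 := by
  have h1 : ∑ a : A, lineSum (cls K) a = 420 := by
    simp only [lineSum]
    rw [sum_sum_pts fun _ x => cls K x]
    simp only [sum_const, card_lns h.order_eq]
    rw [← smul_sum, sum_cls, hc]
    norm_num
  have h2 : ∑ a : A, lineSum (cls K) a ^ 2 = 7056 + 4 * ∑ x, cls K x ^ 2 := by
    have : ∀ a : A, lineSum (cls K) a ^ 2 = ∑ x ∈ pts X a, cls K x * lineSum (cls K) a :=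
      fun a => by rw [← sum_mul, ← lineSum, pow_two]
    rw [sum_congr rfl fun a _ => this a, sum_sum_pts]
    have h3 : ∀ x, ∑ a ∈ lns A x, cls K x * lineSum (cls K) a
        = 84 * cls K x + 4 * cls K x ^ 2 := fun x => by
      rw [← mul_sum, h.sum_lineSum_cls hc]
      ring
    rw [sum_congr rfl fun x _ => h3 x, sum_add_distrib, ← mul_sum, ← mul_sum, sum_cls, hc]
    norm_num
  have h3 : ∑ a : A, ∑ x ∈ pts X a, (cls K x ^ 2 - 4 * ∑ t, seg σ K a x t ^ 2)
      = ∑ x, cls K x ^ 2 - 16 * 84 := by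
    rw [sum_sum_pts]
    have h4 : ∀ x, ∑ a ∈ lns A x, (cls K x ^ 2 - 4 * ∑ t, seg σ K a x t ^ 2)
        = cls K x ^ 2 - 16 * cls K x := fun x => by
      rw [sum_sub_distrib, ← mul_sum, h.sum_seg_sq, sum_const, card_lns h.order_eq]
      norm_num
      ring
    rw [sum_congr rfl fun x _ => h4 x, sum_sub_distrib, ← mul_sum, sum_cls, hc]
    norm_num
  rw [sum_congr rfl fun a _ => h.classDefect_eq hK a, sum_add_distrib, sum_sub_distrib, ← mul_sum,
    h1, h2, h3]
  ring

theorem defectBound_le (h : IsNetPlane σ τ) (hK : ∀ a b, lineMult σ τ K a b ≤ 6) (a : A)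
    (e : Fin 5 → X) (he : Enumerates e (pts X a)) :
    defectBound (fun i => cls K (e i)) ≤ classDefect σ τ K a := by
  have hb : Function.Bijective fun i => (⟨e i, mem_pts.1 (he.mem i)⟩ : {x : X // x ∈ a}) := by
    refine ⟨fun i j hij => he.injective (congrArg Subtype.val hij), fun ⟨x, hx⟩ => ?_⟩
    obtain ⟨i, hi⟩ := (he.mem_iff x).1 (mem_pts.2 hx)
    exact ⟨i, Subtype.ext hi⟩
  have h1 := ((h.isLineClass hK a).comp_equiv (Equiv.ofBijective _ hb)).defectBound_le
  rw [IsLineClass.defect_comp_equiv (τ := fun (x : {x : X // x ∈ a}) b => τ a x b)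
    (w := fun (x : {x : X // x ∈ a}) t => seg σ K a x t)] at h1
  refine le_trans (le_of_eq ?_) h1
  congr 1
  ext i
  exact (sum_seg σ K a (e i)).symm

theorem lineSum_le (h : IsNetPlane σ τ) (hK : ∀ a b, lineMult σ τ K a b ≤ 6) {a : A} {x : X}
    (hx : x ∈ a) (h5 : 5 ≤ cls K x) : lineSum (cls K) a ≤ 16 + cls K x := by
  have := (h.isLineClass hK a).totalMult_le (i := ⟨x, hx⟩)
  rw [IsLineClass.classMult, sum_seg, totalMult_seg] at this
  exact this h5

/-- In a neighbour class of multiplicity `5` or `6`, the sums of squares of the multiplicities of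
the line segments are the same in all directions. -/
theorem sum_seg_sq_eq (h : IsNetPlane σ τ) (hK : ∀ a b, lineMult σ τ K a b ≤ 6) (hc : #K = 84)
    {x : X} (h5 : 5 ≤ cls K x) {a : A} (hx : x ∈ a) :
    5 * ∑ t, seg σ K a x t ^ 2 = cls K x ^ 2 + 4 * cls K x := by
  have h6 := h.cls_le_six hK hc x
  -- The other four lines have at most 16 + u each, leaving 84 + 4u - 4 (16 + u) = 20. Segments then
  -- have at most 2 points, and the resulting maximum of the sum of squares, 9 or 12, equals the
  -- average over the five directions.
  have hge : ∀ b ∈ lns A x, 20 ≤ lineSum (cls K) b := by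
    intro b hb
    have h1 := h.sum_lineSum_cls hc x
    rw [← add_sum_erase _ _ hb] at h1
    have h2 := sum_le_sum fun c (hc : c ∈ (lns A x).erase b) =>
      h.lineSum_le hK (mem_lns.1 (mem_of_mem_erase hc)) h5
    rw [sum_const, card_erase_of_mem hb, card_lns h.order_eq] at h2
    norm_num at h2
    linarith
  have hle : ∀ b ∈ lns A x, 5 * ∑ t, seg σ K b x t ^ 2 ≤ cls K x ^ 2 + 4 * cls K x := by
    intro b hb
    have h1 : ∀ t ∈ univ, 0 ≤ seg σ K b x t ∧ seg σ K b x t ≤ 2 := fun t _ => by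
      have h1 := h.seg_le hK (mem_lns.1 hb) t
      have h2 := hge b hb
      exact ⟨seg_nonneg b x t, by omega⟩
    have h2 := sum_sq_le_sqBound univ _ 2 h1
    rw [sum_seg] at h2
    obtain h7 | h7 : cls K x = 5 ∨ cls K x = 6 := by omega
    all_goals rw [h7] at h2 ⊢; norm_num [sqBound] at h2; linarith
  have hsum : ∑ b ∈ lns A x, 5 * ∑ t, seg σ K b x t ^ 2
      = ∑ b ∈ lns A x, (cls K x ^ 2 + 4 * cls K x) := by
    rw [← mul_sum, h.sum_seg_sq, sum_const, card_lns h.order_eq]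
    norm_num
  exact (sum_eq_sum_iff_of_le hle).1 hsum a (mem_lns.2 hx)

theorem isReducedArc (h : IsNetPlane σ τ) (hK : ∀ a b, lineMult σ τ K a b ≤ 6) (hc : #K = 84) :
    IsReducedArc (A := A) (cls K) (classDefect σ τ K) where
  order_eq := h.order_eq
  nonneg := cls_nonneg
  le_six := h.cls_le_six hK hc
  sum_eq := by rw [sum_cls, hc]; norm_num
  sum_defect := h.sum_classDefect hK hc
  defect_nonneg a := (h.isLineClass hK a).defect_nonneg
  defectBound_le := h.defectBound_le hK
  lineSum_le_of_five x a hx h5 := by linarith [h.lineSum_le hK hx h5.ge]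
  lineSum_le_of_six x a hx h6 := by linarith [h.lineSum_le hK hx (by rw [h6]; norm_num)]
  two_sixes x y a hx hy hxy h6 h6' := by
    have h1 := h.sum_seg_sq_eq hK hc (by rw [h6]; norm_num) hx
    have h2 := h.sum_seg_sq_eq hK hc (by rw [h6']; norm_num) hy
    rw [h6] at h1
    rw [h6'] at h2
    rw [← totalMult_seg (σ := σ)]
    refine (h.isLineClass hK a).totalMult_ne_of_six_six (i := ⟨x, hx⟩) (j := ⟨y, hy⟩)
      (fun h => hxy (congrArg Subtype.val h)) ?_ ?_ (by linarith) (by linarith)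
    · rw [IsLineClass.classMult, sum_seg, h6]
    · rw [IsLineClass.classMult, sum_seg, h6']
  two_fives_four x y z a hx hy hz hxy h5 h5' h4 := by
    have h1 := h.sum_seg_sq_eq hK hc (by rw [h5]) hx
    have h2 := h.sum_seg_sq_eq hK hc (by rw [h5']) hy
    rw [h5] at h1
    rw [h5'] at h2
    rw [← totalMult_seg (σ := σ)]
    refine (h.isLineClass hK a).totalMult_ne_of_five_five_four (i := ⟨x, hx⟩) (j := ⟨y, hy⟩)
      (k := ⟨z, hz⟩) (fun h => hxy (congrArg Subtype.val h)) ?_ ?_ ?_ (by linarith) (by linarith)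
    · rw [IsLineClass.classMult, sum_seg, h5]
    · rw [IsLineClass.classMult, sum_seg, h5']
    · rw [IsLineClass.classMult, sum_seg, h4]
  four_fives a e he h5 := by
    rw [← totalMult_seg (σ := σ)]
    have h6 : ∀ x : {x : X // x ∈ a}, x ≠ ⟨e 4, mem_pts.1 (he.mem 4)⟩ → cls K x = 5 := by
      rintro ⟨x, hx⟩ hne
      obtain ⟨i, rfl⟩ := (he.mem_iff x).1 (mem_pts.2 hx)
      exact h5 i fun h => hne (Subtype.ext (congrArg e h))
    refine (h.isLineClass hK a).totalMult_ne_of_four_fives (k := ⟨e 4, mem_pts.1 (he.mem 4)⟩)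
      (fun x hx => ?_) fun x hx => ?_
    · rw [IsLineClass.classMult, sum_seg, h6 x hx]
    · have := h.sum_seg_sq_eq hK hc (by rw [h6 x hx]) x.2
      rw [h6 x hx] at this
      linarith

theorem cls_eq_four (h : IsNetPlane σ τ) (hK : ∀ a b, lineMult σ τ K a b ≤ 6) (hc : #K = 84)
    (x : X) : cls K x = 4 :=
  (h.isReducedArc hK hc).eq_four x

/-- All lines have multiplicity `2` or `6` with respect to an `(84, 6)`-arc. -/
theorem lineMult_eq (h : IsNetPlane σ τ) (hK : ∀ a b, lineMult σ τ K a b ≤ 6) (hc : #K = 84)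
    (a : A) (b : B) : lineMult σ τ K a b = 2 ∨ lineMult σ τ K a b = 6 := by
  rw [← mult_seg]
  exact (h.isLineClass hK a).mult_eq_of_fours
    (fun x => by rw [IsLineClass.classMult, sum_seg, h.cls_eq_four hK hc])
    ((h.isReducedArc hK hc).defect_eq a) b

theorem card_le (h : IsNetPlane σ τ) (hK : ∀ a b, lineMult σ τ K a b ≤ 6) : #K ≤ 84 := by
  by_contra! hlt
  have hmono : ∀ L ⊆ K, ∀ a b, lineMult σ τ L a b ≤ 6 := fun L hL a b =>
    (Nat.cast_le.2 (card_le_card (filter_subset_filter _ hL))).trans (hK a b)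
  obtain ⟨L, hLK, hL⟩ := exists_subset_card_eq (show 85 ≤ #K from hlt)
  have hcls : ∀ p ∈ L, ∀ x, cls L x = 4 + if p.1 = x then 1 else 0 := by
    intro p hp x
    have h1 := h.cls_eq_four (hmono _ ((erase_subset p L).trans hLK))
      (by rw [card_erase_of_mem hp, hL]) x
    rw [cls, filter_erase] at h1
    rw [cls]
    split_ifs with hpx
    · rw [card_erase_of_mem (mem_filter.2 ⟨hp, hpx⟩)] at h1
      omega
    · rw [erase_eq_of_notMem (s := {q ∈ L | q.1 = x}) fun hm => hpx (mem_filter.1 hm).2] at h1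
      rw [h1, add_zero]
  obtain ⟨p, hp⟩ : L.Nonempty := card_pos.1 (by omega)
  have hall : ∀ q ∈ L, q.1 = p.1 := by
    intro q hq
    have h1 := hcls p hp p.1
    have h2 := hcls q hq p.1
    rw [h1] at h2
    by_contra hne
    simp [hne] at h2
  have h1 := sum_cls L
  have h2 : cls L p.1 = 85 := by
    rw [cls, filter_true_of_mem hall, hL]
    norm_num
  have h3 := hcls p hp p.1
  rw [h2] at h3
  simp at h3

/-- There is no `(84, 6)`-arc if there is a set of `21` lines, one in each neighbour class, that
meets every point in `1` or `5` lines. -/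
theorem card_lt (h : IsNetPlane σ τ) (hK : ∀ a b, lineMult σ τ K a b ≤ 6) (b₀ : A → B)
    (hb : ∀ p : X × Y, #{a : A | p.1 ∈ a ∧ σ a p.1 p.2 = τ a p.1 (b₀ a)} % 4 = 1) : #K < 84 := by
  refine lt_of_le_of_ne (h.card_le hK) fun hc => ?_
  -- Count incidences of the arc with the chosen lines in two ways modulo 4: 84 · 1 by points, 21 ·
  -- 2 by lines.
  have h1 : ∑ a, #{p ∈ K | p.1 ∈ a ∧ σ a p.1 p.2 = τ a p.1 (b₀ a)}
      = ∑ p ∈ K, #{a : A | p.1 ∈ a ∧ σ a p.1 p.2 = τ a p.1 (b₀ a)} :=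
    sum_card_bipartiteAbove_eq_sum_card_bipartiteBelow _
  have h2 : (∑ p ∈ K, #{a : A | p.1 ∈ a ∧ σ a p.1 p.2 = τ a p.1 (b₀ a)}) % 4 = 0 := by
    rw [sum_nat_mod, sum_congr rfl fun p _ => hb p, sum_const, hc]
    norm_num
  have h3 : (∑ a, #{p ∈ K | p.1 ∈ a ∧ σ a p.1 p.2 = τ a p.1 (b₀ a)}) % 4 = 2 := by
    have : ∀ a, #{p ∈ K | p.1 ∈ a ∧ σ a p.1 p.2 = τ a p.1 (b₀ a)} % 4 = 2 := fun a => by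
      have h4 := h.lineMult_eq hK hc a (b₀ a)
      rw [lineMult] at h4
      omega
    rw [sum_nat_mod, sum_congr rfl fun a _ => this a, sum_const, card_univ,
      (h.isReducedArc hK hc).card_lines]
    norm_num
  omega

end IsNetPlane

/-! ### Coordinates over the residue field. -/

namespace HjelmslevCoordinates

open Configuration Configuration.ofField Matrix

open scoped LinearAlgebra.Projectivization

variable {F : Type*} [Field F]

/-- The position of a nonzero entry of the representative of a point. -/
noncomputable def pivot (p : ℙ F (Fin 3 → F)) : Fin 3 :=
  (Function.ne_iff.1 p.rep_nonzero).choose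

theorem rep_pivot (p : ℙ F (Fin 3 → F)) : p.rep (pivot p) ≠ 0 :=
  (Function.ne_iff.1 p.rep_nonzero).choose_spec

/-- The standard complement to the span of the representative of a point. -/
noncomputable def lift (p : ℙ F (Fin 3 → F)) (y : Fin 2 → F) : Fin 3 → F :=
  Fin.insertNth (α := fun _ => F) (pivot p) 0 y

@[simp] theorem lift_pivot (p : ℙ F (Fin 3 → F)) (y : Fin 2 → F) : lift p y (pivot p) = 0 := by
  simp [lift]

theorem lift_injective (p : ℙ F (Fin 3 → F)) : Function.Injective (lift p) := by
  intro y y' h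
  ext j
  have := congrFun h ((pivot p).succAbove j)
  simpa [lift] using this

theorem exists_lift (p : ℙ F (Fin 3 → F)) (v : Fin 3 → F) :
    ∃ (y : Fin 2 → F) (d : F), lift p y = v + d • p.rep := by
  refine ⟨fun j => (v + (-(v (pivot p) / p.rep (pivot p))) • p.rep) ((pivot p).succAbove j),
    -(v (pivot p) / p.rep (pivot p)), ?_⟩
  ext i
  obtain rfl | ⟨j, rfl⟩ := Fin.eq_self_or_eq_succAbove (pivot p) i
  · have := rep_pivot p
    simp
    field_simp
    ring
  · simp [lift]

theorem mem_iff_rep (x a : ℙ F (Fin 3 → F)) : x ∈ a ↔ x.rep ⬝ᵥ a.rep = 0 := by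
  rw [mem_iff]
  conv_lhs => rw [← x.mk_rep, ← a.mk_rep]
  rw [Projectivization.orthogonal_mk]

theorem mk_mem_iff {z : Fin 3 → F} (hz : z ≠ 0) (a : ℙ F (Fin 3 → F)) :
    Projectivization.mk F z hz ∈ a ↔ z ⬝ᵥ a.rep = 0 := by
  rw [mem_iff]
  conv_lhs => rw [← a.mk_rep]
  rw [Projectivization.orthogonal_mk]

theorem mk_ne {z : Fin 3 → F} (hz : z ≠ 0) {x : ℙ F (Fin 3 → F)} (hp : z (pivot x) = 0) :
    Projectivization.mk F z hz ≠ x := by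
  rintro rfl
  obtain ⟨u, hu⟩ := Projectivization.exists_smul_eq_mk_rep F z hz
  refine rep_pivot (Projectivization.mk F z hz) ?_
  rw [← hu, Pi.smul_apply, hp, smul_zero]

/-- A nonzero `z` would represent the intersection point `x` of `a` and `a'`, whose representative
does not vanish at the pivot. This is what makes two labels determine the coordinates in the nets.
-/
theorem eq_zero_of_mem {x a a' : ℙ F (Fin 3 → F)} (hx : x ∈ a) (hx' : x ∈ a') (haa : a ≠ a')
    {z : Fin 3 → F} (hz : z ⬝ᵥ a.rep = 0) (hz' : z ⬝ᵥ a'.rep = 0) (hp : z (pivot x) = 0) :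
    z = 0 := by
  by_contra h0
  obtain h | h := Nondegenerate.eq_or_eq ((mk_mem_iff h0 a).2 hz) hx
    ((mk_mem_iff h0 a').2 hz') hx'
  · exact mk_ne h0 hp h
  · exact haa h

theorem mem_comm {x a : ℙ F (Fin 3 → F)} : x ∈ a ↔ a ∈ x := by
  rw [mem_iff, mem_iff, Projectivization.orthogonal_comm]

/-- The correction term in a sum of three representatives of elements of the residue field. -/
def carry (c : F → F → F) (z : Fin 3 → F) : F := c (z 0) (z 1) + c (z 0 + z 1) (z 2)

/-- The line segment in the direction `a` of the point with coordinates `(x, y)`. -/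
noncomputable def pointLabel (c : F → F → F) (a x : ℙ F (Fin 3 → F)) (y : Fin 2 → F) : F :=
  lift x y ⬝ᵥ a.rep + carry c fun i => a.rep i * x.rep i

/-- The line segment in the neighbour class `x` of the line with coordinates `(a, b)`. -/
noncomputable def lineLabel (φ : F →+* F) (a x : ℙ F (Fin 3 → F)) (b : Fin 2 → F) : F :=
  -φ (lift a b ⬝ᵥ x.rep)

variable [Fintype F] [DecidableEq F] [Fintype (ℙ F (Fin 3 → F))]

theorem order_eq (hF : Fintype.card F = 4) :
    ProjectivePlane.order (ℙ F (Fin 3 → F)) (ℙ F (Fin 3 → F)) = 4 := by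
  have h1 := ProjectivePlane.card_points (ℙ F (Fin 3 → F)) (ℙ F (Fin 3 → F))
  have h2 := Projectivization.card_of_finrank F (Fin 3 → F) (n := 3) (by simp)
  rw [Nat.card_eq_fintype_card, Nat.card_eq_fintype_card, hF, h1] at h2
  simp only [sum_range_succ, sum_range_zero] at h2
  nlinarith

open scoped Classical in
theorem isNetPlane (hF : Fintype.card F = 4) (c : F → F → F) (φ : F →+* F) :
    IsNetPlane (pointLabel c) (lineLabel φ) where
  order_eq := order_eq hF
  point_net x :=
    { card_index := by
        have := ProjectivePlane.lineCount_eq (L := ℙ F (Fin 3 → F)) x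
        rwa [order_eq hF, lineCount, Nat.card_eq_fintype_card] at this
      card_points := by simp [hF]
      card_labels := hF
      injective := by
        rintro ⟨a, ha⟩ ⟨a', ha'⟩ hne y y' h
        simp only [pointLabel, Prod.mk.injEq, add_left_inj] at h
        refine lift_injective x (sub_eq_zero.1 (eq_zero_of_mem ha ha' ?_ ?_ ?_ ?_))
        · exact fun h => hne (Subtype.ext h)
        · rw [sub_dotProduct, h.1, sub_self]
        · rw [sub_dotProduct, h.2, sub_self]
        · simp }
  line_net a :=
    { card_index := by
        have := ProjectivePlane.pointCount_eq (P := ℙ F (Fin 3 → F)) a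
        rwa [order_eq hF, pointCount, Nat.card_eq_fintype_card] at this
      card_points := by simp [hF]
      card_labels := hF
      injective := by
        rintro ⟨x, hx⟩ ⟨x', hx'⟩ hne b b' h
        simp only [lineLabel, Prod.mk.injEq, neg_inj, φ.injective.eq_iff] at h
        refine lift_injective a (sub_eq_zero.1
          (eq_zero_of_mem (mem_comm.1 hx) (mem_comm.1 hx') ?_ ?_ ?_ ?_))
        · exact fun h => hne (Subtype.ext h)
        · rw [sub_dotProduct, h.1, sub_self]
        · rw [sub_dotProduct, h.2, sub_self]
        · simp }

open scoped Classical in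
/-- If representatives are closed under addition, the lines whose coefficients are representatives
of elements of the residue field meet every point in `1` or `5` lines. -/
theorem card_lines_zero_mod_four (hF : Fintype.card F = 4) (φ : F →+* F)
    (x : ℙ F (Fin 3 → F)) (y : Fin 2 → F) :
    #{a : ℙ F (Fin 3 → F) | x ∈ a ∧ pointLabel (fun _ _ => 0) a x y = lineLabel φ a x 0} % 4
      = 1 := by
  have h0 : ∀ a : ℙ F (Fin 3 → F), pointLabel (fun _ _ => 0) a x y = lineLabel φ a x 0 ↔
      lift x y ⬝ᵥ a.rep = 0 := by
    intro a
    have : lift a 0 = 0 := by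
      ext i
      obtain rfl | ⟨j, rfl⟩ := Fin.eq_self_or_eq_succAbove (pivot a) i <;> simp [lift]
    simp [pointLabel, lineLabel, carry, this]
  simp only [h0]
  -- With no correction term, incidence means that `a` contains `x` and is orthogonal to `lift x y`.
  -- If the latter is zero there are five such lines; otherwise it represents a second point, and
  -- exactly one line joins the two.
  by_cases hy : lift x y = 0
  · simp only [hy, zero_dotProduct, and_true]
    have := ReducedArc.card_lns (A := ℙ F (Fin 3 → F)) (order_eq hF) x
    rw [ReducedArc.lns] at this
    rw [this]
  · have := ReducedArc.card_lns_inter (A := ℙ F (Fin 3 → F)) (mk_ne hy (lift_pivot x y)).symm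
    rw [ReducedArc.lns, ReducedArc.lns, ← filter_and] at this
    simp only [mk_mem_iff] at this
    rw [this]

end HjelmslevCoordinates

/-! ### Coordinates for chain rings of length two. -/

/-- Coordinates for a chain ring `R` of length two with residue field `F`: every element is of the
form `t a + ι b`, where the multiplicative map `t` is a section of the reduction, `ι` identifies
`F` with the radical, `φ` describes the right action of `F` on the radical, and `c` describes the
failure of `t` to be additive. -/
structure IsChainCoordinates {F R : Type*} [Field F] [Ring R] (t : F →*₀ R) (ι : F →+ R)
    (φ : F →+* F) (c : F → F → F) : Prop where
  teich_mul : ∀ a b, t a * ι b = ι (a * b)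
  mul_teich : ∀ a b, ι b * t a = ι (b * φ a)
  mul_rad : ∀ a b, ι a * ι b = 0
  ne_zero : ι 1 ≠ 0
  exists_eq : ∀ r, ∃ a b, r = t a + ι b
  add_teich : ∀ a b, t a + t b = t (a + b) + ι (c a b)

namespace IsChainCoordinates

variable {F R : Type*} [Field F] [Ring R] {t : F →*₀ R} {ι : F →+ R} {φ : F →+* F}
  {c : F → F → F}

theorem of_ringEquiv {S : Type*} [Ring S] (h : IsChainCoordinates t ι φ c) (e : R ≃+* S) :
    IsChainCoordinates ((e : R →+* S).toMonoidWithZeroHom.comp t)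
      (((e : R →+* S) : R →+ S).comp ι) φ c where
  teich_mul a b := by simp [← map_mul, h.teich_mul]
  mul_teich a b := by simp [← map_mul, h.mul_teich]
  mul_rad a b := by simp [← map_mul, h.mul_rad]
  ne_zero := by simpa using h.ne_zero
  exists_eq s := by
    obtain ⟨a, b, hab⟩ := h.exists_eq (e.symm s)
    exact ⟨a, b, by simp [← map_add, ← hab]⟩
  add_teich a b := by simp [← map_add, h.add_teich]

theorem mul_eq (h : IsChainCoordinates t ι φ c) (a b a' b' : F) :
    (t a + ι b) * (t a' + ι b') = t (a * a') + ι (a * b' + b * φ a') := by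
  rw [add_mul, mul_add, mul_add, h.teich_mul, h.mul_teich, h.mul_rad, map_mul t, map_add ι, add_zero,
    add_assoc]

open HjelmslevCoordinates in
theorem sum_eq (h : IsChainCoordinates t ι φ c) (z w : Fin 3 → F) :
    ∑ i, (t (z i) + ι (w i)) = t (∑ i, z i) + ι (∑ i, w i + carry c z) := by
  rw [sum_add_distrib, ← map_sum ι, Fin.sum_univ_three fun i => t (z i), 
    h.add_teich (z 0), add_right_comm (t _) _ (t _), h.add_teich, Fin.sum_univ_three z, carry, map_add ι, map_add ι]
  abel

end IsChainCoordinates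

/-! ### From the Hjelmslev plane over `R` to coordinates. -/

namespace PHG

open HjelmslevCoordinates Matrix MulOpposite

open Configuration Configuration.ofField

open scoped LinearAlgebra.Projectivization

variable {F R : Type*} [Field F] [Ring R] {t : F →*₀ R} {ι : F →+ R} {φ : F →+* F}
  {c : F → F → F}

/-- The generator of the point with coordinates `(x, y)`. -/
noncomputable def pointVec (t : F →*₀ R) (ι : F →+ R) (x : ℙ F (Fin 3 → F)) (y : Fin 2 → F) :
    Fin 3 → R := fun i => t (x.rep i) + ι (lift x y i)

/-- The coefficients of the equation of the line with coordinates `(a, b)`. -/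
noncomputable def lineVec (t : F →*₀ R) (ι : F →+ R) (φ : F →+* F) (a : ℙ F (Fin 3 → F))
    (b : Fin 2 → F) : Fin 3 → R := fun i => t (a.rep i) + ι (φ (lift a b i))

/-- The solutions of a linear equation with coefficients on the left. -/
def hyperplane (l : Fin 3 → R) : Submodule Rᵐᵒᵖ (Fin 3 → R) where
  carrier := {v | ∑ i, l i * v i = 0}
  add_mem' {v w} hv hw := by
    simp only [Set.mem_ofPred_eq, Pi.add_apply, mul_add, sum_add_distrib] at *
    rw [hv, hw, add_zero]
  zero_mem' := by simp
  smul_mem' r v hv := by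
    simp only [Set.mem_ofPred_eq, Pi.smul_apply, smul_eq_mul_unop, ← mul_assoc, ← sum_mul] at *
    rw [hv, zero_mul]

theorem mem_hyperplane {l v : Fin 3 → R} : v ∈ hyperplane l ↔ ∑ i, l i * v i = 0 := Iff.rfl

theorem isFreeOfRank_hyperplane {l : Fin 3 → R} (k : Fin 3) (hk : IsUnit (l k)) :
    IsFreeOfRank 2 (hyperplane l) := by
  obtain ⟨u, hu⟩ := hk
  refine ⟨Module.Basis.ofEquivFun
    { toFun := fun v j => op (v.1 (k.succAbove j))
      map_add' := fun v w => rfl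
      map_smul' := fun r v => by
        ext j
        simp
      invFun := fun w => ⟨Fin.insertNth (α := fun _ => R) k
        (-(↑u⁻¹ * ∑ j, l (k.succAbove j) * unop (w j))) fun j => unop (w j), ?_⟩
      left_inv := fun v => ?_
      right_inv := fun w => ?_ }⟩
  · rw [mem_hyperplane, Fin.sum_univ_succAbove _ k, ← hu]
    simp
  · ext i
    obtain rfl | ⟨j, rfl⟩ := Fin.eq_self_or_eq_succAbove k i
    · have := mem_hyperplane.1 v.2
      rw [Fin.sum_univ_succAbove _ i, ← hu, add_eq_zero_iff_neg_eq] at this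
      simp [← this]
    · simp
  · ext j
    simp

/-- The line with coordinates `(a, b)`. -/
noncomputable def lineOf (t : F →*₀ R) (ι : F →+ R) (φ : F →+* F) (a : ℙ F (Fin 3 → F))
    (b : Fin 2 → F) : Line R :=
  ⟨hyperplane (lineVec t ι φ a b), isFreeOfRank_hyperplane (pivot a) (by
    simpa [lineVec] using (IsUnit.mk0 _ (rep_pivot a)).map t)⟩

/-- The residue part of the product vanishes because `x` is on `a`. Twisting the line coordinates by
`φ` turns the radical part into a label of the point minus a label of the line. -/
theorem sum_lineVec_mul (h : IsChainCoordinates t ι φ c) (x a : ℙ F (Fin 3 → F))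
    (y b : Fin 2 → F) (hxa : x ∈ a) :
    ∑ i, lineVec t ι φ a b i * pointVec t ι x y i
      = ι (pointLabel c a x y - lineLabel φ a x b) := by
  simp only [lineVec, pointVec, h.mul_eq]
  rw [h.sum_eq]
  have h1 : ∑ i, a.rep i * x.rep i = 0 := by
    rw [mem_iff_rep, dotProduct_comm] at hxa
    exact hxa
  rw [h1, map_zero, zero_add, pointLabel, lineLabel, dotProduct_comm, sub_neg_eq_add]
  simp only [dotProduct, map_sum, map_mul, sum_add_distrib]
  congr 1
  ring

/-- A generator of a free module has nonzero residue, for otherwise `ι 1` would annihilate it.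
Multiplying by a unit `t m * (1 + ι d)` moves the residue to the chosen representative and clears
the radical part at the pivot. -/
theorem exists_pointVec (h : IsChainCoordinates t ι φ c) (N : Point R) :
    ∃ x y, N.1 = Submodule.span Rᵐᵒᵖ {pointVec t ι x y} := by
  obtain ⟨N, ⟨e⟩⟩ := N
  set v : Fin 3 → R := (e 0).1 with hv
  have hspan : N = Submodule.span Rᵐᵒᵖ {v} := by
    have h1 := congrArg (Submodule.map N.subtype) e.span_eq
    rw [Submodule.map_span, Submodule.map_top, Submodule.range_subtype] at h1
    rw [← h1]
    congr 1
    ext w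
    simp [hv, Set.range_unique]
  have hfree : ∀ r : R, (∀ i, v i * r = 0) → r = 0 := by
    intro r hr
    have h1 := Fintype.linearIndependent_iff.1 e.linearIndependent (fun _ => op r) (by
      ext i
      simpa using hr i) 0
    simpa using h1
  choose a b hab using fun i => h.exists_eq (v i)
  have ha : a ≠ 0 := by
    rintro rfl
    refine h.ne_zero (hfree _ fun i => ?_)
    rw [hab, Pi.zero_apply, map_zero, zero_add, h.mul_rad]
  set x := Projectivization.mk F a ha
  obtain ⟨m, hm⟩ := Projectivization.exists_smul_eq_mk_rep F a ha
  obtain ⟨y, d, hy⟩ := exists_lift x fun i => b i * φ m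
  have hr : ∀ i, v i * (t m * (1 + ι d)) = pointVec t ι x y i := by
    intro i
    have h1 : t m * (1 + ι d) = t m + ι (m * d) := by rw [mul_add, mul_one, h.teich_mul]
    have h2 : x.rep i = m * a i := by rw [← hm]; rfl
    rw [h1, hab, h.mul_eq, pointVec, hy, Pi.add_apply, Pi.smul_apply, h2, smul_eq_mul]
    congr 2 <;> ring
  have hu : IsUnit (t m * (1 + ι d)) := by
    refine ((m.isUnit).map t).mul ⟨⟨1 + ι d, 1 - ι d, ?_, ?_⟩, rfl⟩
    · simp [mul_sub, add_mul, h.mul_rad]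
    · simp [mul_add, sub_mul, h.mul_rad]
  refine ⟨x, y, ?_⟩
  obtain ⟨u, hu⟩ := hu
  have h3 : pointVec t ι x y = op (u : R) • v := by
    ext i
    rw [Pi.smul_apply, op_smul_eq_mul, hu, hr]
  refine hspan.trans ?_
  rw [h3]
  exact (Submodule.span_singleton_smul_eq u.isUnit.op v).symm

open scoped Classical in
/-- A projective `(k, n)`-arc in coordinates. -/
theorem exists_coordinates (h : IsChainCoordinates t ι φ c) {K : Multiset (Point R)}
    (hK : IsProjective K) {n : ℕ} (hn : ∀ L, lineMult K L ≤ n) :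
    ∃ S : Finset (_ × (Fin 2 → F)), #S = K.card ∧
      ∀ a b, IsNetPlane.lineMult (pointLabel c) (lineLabel φ) S a b ≤ n := by
  choose x y hxy using exists_pointVec h
  have hinj : Function.Injective fun N => (x N, y N) := by
    intro N N' hN
    simp only [Prod.mk.injEq] at hN
    exact Subtype.ext (by rw [hxy N, hxy N', hN.1, hN.2])
  refine ⟨(⟨K, hK⟩ : Finset (Point R)).map ⟨_, hinj⟩, card_map _, fun a b => ?_⟩
  -- Only one direction is needed: coordinate incidence implies incidence with an actual line, so
  -- coordinate multiplicities cannot exceed the true ones.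
  refine le_trans (Nat.cast_le.2 ?_) (Nat.cast_le.2 (hn (lineOf t ι φ a b)))
  rw [filter_map, card_map, lineMult, Multiset.countP_eq_card_filter]
  refine card_le_card (t := ({N ∈ (⟨K, hK⟩ : Finset (Point R)) | Incident N (lineOf t ι φ a b)}))
    (monotone_filter_right _ fun N _ hN => ?_)
  rw [Incident, hxy N, Submodule.span_singleton_le_iff_mem]
  obtain ⟨h1, h2⟩ := hN
  exact (sum_lineVec_mul h _ _ _ _ h1).trans
    ((congrArg ι (sub_eq_zero.2 h2)).trans (map_zero ι))

variable [Fintype F]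

theorem card_le (hF : Fintype.card F = 4) (h : IsChainCoordinates t ι φ c)
    {K : Multiset (Point R)} (hK : IsProjective K) (hn : ∀ L, lineMult K L ≤ 6) :
    K.card ≤ 84 := by
  classical
  have := Fintype.ofFinite (Projectivization F (Fin 3 → F))
  obtain ⟨S, hS, h6⟩ := exists_coordinates h hK hn
  rw [← hS]
  exact (isNetPlane hF c φ).card_le h6

theorem card_lt (hF : Fintype.card F = 4) (h : IsChainCoordinates t ι φ fun _ _ => 0)
    {K : Multiset (Point R)} (hK : IsProjective K) (hn : ∀ L, lineMult K L ≤ 6) :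
    K.card < 84 := by
  classical
  have := Fintype.ofFinite (Projectivization F (Fin 3 → F))
  obtain ⟨S, hS, h6⟩ := exists_coordinates h hK hn
  rw [← hS]
  refine (isNetPlane hF (fun _ _ => 0) φ).card_lt h6 (fun _ => 0) fun p => ?_
  convert card_lines_zero_mod_four hF φ p.1 p.2

end PHG

/-! ### Chain coordinates for the three rings. -/

namespace TruncSkewPoly

variable {F : Type*} [Field F] {σ : F →+* F}

/-- The embedding of `F` as the multiples of the indeterminate. -/
def radHom : F →+ TruncSkewPoly F σ where
  toFun b := ⟨0, b⟩
  map_zero' := rfl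
  map_add' a b := by ext <;> simp

/-- The section is the embedding of the subfield of constants, which is additive; hence the
correction `c` is zero. -/
theorem isChainCoordinates :
    IsChainCoordinates (C : F →+* TruncSkewPoly F σ).toMonoidWithZeroHom radHom σ
      fun _ _ => 0 where
  teich_mul a b := by ext <;> simp [C, radHom]
  mul_teich a b := by ext <;> simp [C, radHom]
  mul_rad a b := by ext <;> simp [radHom]
  ne_zero h := by simpa [radHom] using congrArg c1 h
  exists_eq r := ⟨r.c0, r.c1, by ext <;> simp [C, radHom]⟩
  add_teich a b := by ext <;> simp [C]

end TruncSkewPoly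

/-- The Teichmüller coordinates of a commutative ring of characteristic `4` with residue field `F`
of order `4`. -/
theorem exists_isChainCoordinates_of_four {F S : Type*} [Field F] [CommRing S] (π : S →+* F)
    (hπ : Function.Surjective π) (hker : ∀ s, π s = 0 → ∃ z, s = 2 * z) (h4 : (4 : S) = 0)
    (h2 : (2 : S) ≠ 0) (hF2 : (2 : F) = 0) (hF : ∀ a : F, a ^ 4 = a) :
    ∃ (t : F →*₀ S) (ι : F →+ S) (c : F → F → F),
      IsChainCoordinates t ι (RingHom.id F) c := by
  choose l hl using hπ
  have hsub : ∀ x y, π x = π y → ∃ z, x = y + 2 * z := fun x y h => by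
    obtain ⟨z, hz⟩ := hker (x - y) (by rw [map_sub, h, sub_self])
    exact ⟨z, by rw [← hz]; ring⟩
  -- Squares depend only on the residue, as (y + 2z)² = y² + 4 (yz + z²).
  have hsq : ∀ x y, π x = π y → x ^ 2 = y ^ 2 := fun x y h => by
    obtain ⟨z, rfl⟩ := hsub x y h
    linear_combination (y * z + z ^ 2) * h4
  have htwo : ∀ x y, π x = π y → 2 * x = 2 * y := fun x y h => by
    obtain ⟨z, rfl⟩ := hsub x y h
    linear_combination z * h4
  -- The Teichmüller representative: squaring any lift of a² is independent of the lift, hence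
  -- multiplicative, and its residue is a⁴ = a.
  let t : F →*₀ S :=
    { toFun := fun a => l (a ^ 2) ^ 2
      map_zero' := (hsq _ 0 (by rw [hl]; simp)).trans (by simp)
      map_one' := (hsq _ 1 (by rw [hl]; simp)).trans (by simp)
      map_mul' := fun a b => by
        rw [← mul_pow]
        exact hsq _ _ (by rw [map_mul, hl, hl, hl, mul_pow]) }
  let ι : F →+ S :=
    { toFun := fun b => 2 * l b
      map_zero' := (htwo _ 0 (by rw [hl]; simp)).trans (by simp)
      map_add' := fun a b => by
        rw [← mul_add]
        exact htwo _ _ (by rw [map_add, hl, hl, hl]) }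
  have ht : ∀ a, π (t a) = a := fun a => by
    change π (l (a ^ 2) ^ 2) = a
    rw [map_pow, hl, ← pow_mul, hF]
  have hι : ∀ z, 2 * z = ι (π z) := fun z => htwo _ _ (by rw [hl])
  have htι : ∀ a b, t a * ι b = ι (a * b) := fun a b => by
    change t a * (2 * l b) = 2 * l (a * b)
    rw [mul_left_comm]
    exact htwo _ _ (by rw [map_mul, ht, hl, hl])
  have hι0 : ∀ b, π (ι b) = 0 := fun b => by
    change π (2 * l b) = 0
    rw [map_mul, map_ofNat, hF2, zero_mul]
  have hdiff : ∀ x y, π x = π y → ∃ b, x = y + ι b := fun x y h => by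
    obtain ⟨z, hz⟩ := hsub x y h
    exact ⟨π z, by rw [hz, hι]⟩
  choose c hc using fun a b => hdiff (t a + t b) (t (a + b)) (by rw [map_add, ht, ht, ht])
  refine ⟨t, ι, c, ⟨htι, fun a b => ?_, fun a b => ?_, ?_, fun r => ?_, hc⟩⟩
  · rw [mul_comm, htι, mul_comm a, RingHom.id_apply]
  · change 2 * l a * (2 * l b) = 0
    linear_combination (l a * l b) * h4
  · have h1 : ι 1 = 2 := by
      rw [← map_one π, ← hι, mul_one]
    rwa [h1]
  · obtain ⟨b, hb⟩ := hdiff r (t (π r)) (by rw [ht])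
    exact ⟨_, b, hb⟩

namespace G4

open Polynomial

theorem monic : (X ^ 2 + X + 1 : (ZMod 4)[X]).Monic := by monicity!

theorem natDegree_eq : (X ^ 2 + X + 1 : (ZMod 4)[X]).natDegree = 2 := by compute_degree!

theorem four_eq_zero : (4 : G4) = 0 := by
  have h : (4 : ZMod 4) = 0 := by decide
  have := congrArg (AdjoinRoot.of (X ^ 2 + X + 1 : (ZMod 4)[X])) h
  rwa [map_ofNat, map_zero] at this

theorem two_ne_zero : (2 : G4) ≠ 0 := by
  intro h
  have h2 : (2 : G4) = AdjoinRoot.mk _ (C 2) := by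
    rw [AdjoinRoot.mk_C, map_ofNat]
  rw [h2, AdjoinRoot.mk_eq_zero] at h
  refine monic.not_dvd_of_natDegree_lt ?_ ?_ h
  · rw [Ne, C_eq_zero]
    decide
  · rw [natDegree_C, natDegree_eq]
    norm_num

theorem exists_eq (s : G4) : ∃ a b : ZMod 4, s = AdjoinRoot.of _ a + AdjoinRoot.of _ b *
    AdjoinRoot.root (X ^ 2 + X + 1 : (ZMod 4)[X]) := by
  obtain ⟨p, rfl⟩ := AdjoinRoot.mk_surjective s
  have h1 : (p %ₘ (X ^ 2 + X + 1)).natDegree ≤ 1 := by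
    have := natDegree_modByMonic_lt p monic (fun h => by
      have := congrArg natDegree h
      rw [natDegree_eq] at this
      simp at this)
    rw [natDegree_eq] at this
    omega
  obtain ⟨b, a, hab⟩ := exists_eq_X_add_C_of_natDegree_le_one h1
  refine ⟨a, b, ?_⟩
  have h2 : AdjoinRoot.mk (X ^ 2 + X + 1 : (ZMod 4)[X]) p =
      AdjoinRoot.mk _ (p %ₘ (X ^ 2 + X + 1)) := by
    rw [AdjoinRoot.mk_eq_mk]
    exact ⟨_, sub_eq_of_eq_add' (modByMonic_add_div p _).symm⟩
  rw [h2, hab]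
  simp [add_comm]

/-- Reduction sends the root of X² + X + 1 to an element `w` of `F` outside {0, 1}. An element a +
bX outside 2 · 𝔾₄ has an odd coefficient, so its residue is 1, `w` or 1 + `w`, never zero. -/
theorem exists_isChainCoordinates {F : Type*} [Field F] [Fintype F] (hF : Fintype.card F = 4)
    (hF2 : (2 : F) = 0) :
    ∃ (t : F →*₀ G4) (ι : F →+ G4) (c : F → F → F),
      IsChainCoordinates t ι (RingHom.id F) c := by
  classical
  have hpow : ∀ a : F, a ^ 4 = a := fun a => by rw [← hF, FiniteField.pow_card]
  obtain ⟨w, hw⟩ : ∃ w : F, w ∉ ({0, 1} : Finset F) := by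
    by_contra! h
    have h1 := card_le_card (fun a _ => h a : (univ : Finset F) ⊆ {0, 1})
    rw [card_univ, hF] at h1
    have := h1.trans card_le_two
    omega
  simp only [mem_insert, mem_singleton, not_or] at hw
  obtain ⟨hw0, hw1⟩ := hw
  have hroot : w ^ 2 + w + 1 = 0 := by
    refine (mul_eq_zero.1 (?_ : w * (w - 1) * (w ^ 2 + w + 1) = 0)).resolve_left
      (mul_ne_zero hw0 (sub_ne_zero.2 hw1))
    linear_combination hpow w
  have : CharP F 2 := CharTwo.of_one_ne_zero_of_two_eq_zero one_ne_zero hF2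
  let f : ZMod 4 →+* F := ZMod.castHom (show 2 ∣ 4 by norm_num) F
  have hf : ∀ a : ZMod 4, (∃ z, a = 2 * z) ∨ f a = 1 := by
    intro a
    have h3 : (3 : F) = 1 := by linear_combination hF2
    fin_cases a
    · exact Or.inl ⟨0, rfl⟩
    · exact Or.inr (map_one f)
    · exact Or.inl ⟨1, rfl⟩
    · exact Or.inr ((map_ofNat f 3).trans h3)
  have hf0 : ∀ z : ZMod 4, f (2 * z) = 0 := fun z => by rw [map_mul, map_ofNat, hF2, zero_mul]
  let π : G4 →+* F := AdjoinRoot.lift f w (by simp [hroot])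
  have hπ : ∀ a b, π (AdjoinRoot.of _ a + AdjoinRoot.of _ b * AdjoinRoot.root _)
      = f a + f b * w := fun a b => by
    rw [map_add, map_mul, AdjoinRoot.lift_of, AdjoinRoot.lift_of, AdjoinRoot.lift_root]
  refine exists_isChainCoordinates_of_four π ?_ ?_ four_eq_zero two_ne_zero hF2 hpow
  · have hcard : #({0, 1, w, 1 + w} : Finset F) = 4 := by
      have h1 : (0 : F) ≠ 1 + w := fun h => hw1 (by linear_combination -h - hF2)
      rw [card_insert_of_notMem, card_insert_of_notMem, card_insert_of_notMem, card_singleton]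
      · simp
      · simp [Ne.symm hw1, hw0]
      · simp [Ne.symm hw0, h1]
    have huniv : ({0, 1, w, 1 + w} : Finset F) = univ :=
      eq_univ_of_card _ (by rw [hcard, hF])
    intro a
    have ha : a ∈ ({0, 1, w, 1 + w} : Finset F) := huniv ▸ mem_univ a
    simp only [mem_insert, mem_singleton] at ha
    obtain rfl | rfl | rfl | rfl := ha
    · exact ⟨0, map_zero π⟩
    · exact ⟨1, map_one π⟩
    · exact ⟨_, (hπ 0 1).trans (by simp)⟩
    · exact ⟨_, (hπ 1 1).trans (by simp)⟩
  · intro s hs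
    obtain ⟨a, b, rfl⟩ := exists_eq s
    rw [hπ] at hs
    obtain ⟨z, rfl⟩ | hb := hf b
    · obtain ⟨y, rfl⟩ | ha := hf a
      · exact ⟨AdjoinRoot.of _ y + AdjoinRoot.of _ z * AdjoinRoot.root _, by
          rw [map_mul, map_mul, map_ofNat]; ring⟩
      · rw [ha, hf0, zero_mul, add_zero] at hs
        exact absurd hs one_ne_zero
    · obtain ⟨y, rfl⟩ | ha := hf a
      · rw [hf0, hb, one_mul, zero_add] at hs
        exact absurd hs hw0
      · rw [ha, hb] at hs
        exact absurd (by linear_combination hs - hF2) hw1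

end G4

theorem card_galoisField_four [Fintype (GaloisField 2 2)] :
    Fintype.card (GaloisField 2 2) = 4 := by
  rw [← Nat.card_eq_fintype_card, GaloisField.card 2 2 (by norm_num)]
  norm_num

theorem mainTheorem10 (R : Type*) [Ring R]
    (hR : Nonempty (R ≃+* G4) ∨ Nonempty (R ≃+* S4) ∨ Nonempty (R ≃+* T4)) :
    PHG.m 6 R ≤ 84 ∧ (¬ Nonempty (R ≃+* G4) → PHG.m 6 R < 84) := by
  have := Fintype.ofFinite (GaloisField 2 2)
  have hF := card_galoisField_four
  have hF2 : (2 : GaloisField 2 2) = 0 := CharTwo.two_eq_zero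
  have hfin : Finite R := by
    obtain ⟨⟨e⟩⟩ | ⟨⟨e⟩⟩ | ⟨⟨e⟩⟩ := hR <;> exact Finite.of_equiv _ e.symm.toEquiv
  obtain ⟨K, hK, hc, h6⟩ := (PHG.isGreatest_m 6 R).1
  rw [← hc]
  have hlt : Nonempty (R ≃+* S4) ∨ Nonempty (R ≃+* T4) → K.card < 84 := by
    rintro (⟨⟨e⟩⟩ | ⟨⟨e⟩⟩)
    · exact PHG.card_lt hF (TruncSkewPoly.isChainCoordinates.of_ringEquiv e.symm) hK h6
    · exact PHG.card_lt hF (TruncSkewPoly.isChainCoordinates.of_ringEquiv e.symm) hK h6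
  refine ⟨?_, fun h => hlt (hR.resolve_left h)⟩
  obtain ⟨⟨e⟩⟩ | h := hR
  · obtain ⟨t, ι, c, h⟩ := G4.exists_isChainCoordinates hF hF2
    exact PHG.card_le hF (h.of_ringEquiv e.symm) hK h6
  · exact (hlt h).le
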